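/- Let $d\ge 1$ and let $X\subset\mathbb R^d$ be a nonempty compact set with $\overline{\operatorname{Int}X}=X$, such that $\partial X$ is smooth ($C^1$ suffices), or $X$ is convex, or, more generally, $X$ satisfies a uniform interior cone condition (each $x\in X$ is the vertex of an open cone of fixed angle and size contained in $\operatorname{Int}X$). For a map $\varphi:X\to X$ put $\|D\varphi\|=\sup_{x\in X}|D\varphi(x)|$. Let $I$ be a finite or countably infinite set. A sequence of families $\Phi^{(n)}=\{\varphi^{(n)}_i:X\to X\}_{i\in I}$, $n\ge 1$, is a *non-autonomous conformal iterated function system* (NCIFS) $\Phi$ if: (a) $\varphi^{(n)}_a(\operatorname{Int}X)\cap\varphi^{(n)}_b(\operatorname{Int}X)=\emptyset$ for all $n$ and $a\ne b$; (b) there is an open connected $V\supset X$ such that every $\varphi_i^{(n)}$ extends to a $C^1$ conformal diffeomorphism of $V$ into $V$; (c) there is $K\ge1$ such that every composition $\varphi=\varphi^{(k)}_{\omega_k}\circ\dots\circ\varphi^{(l)}_{\omega_l}$ (of the extended maps) satisfies $\|D\varphi(x)\|\le K\|D\varphi(y)\|$ for $x,y\in V$; (d) there is $\eta<1$ such that,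 for all sufficiently large $q$, $\|D\varphi(x)\|\le\eta^q$ for all $x\in X$ and all $\varphi=\varphi^{(j)}_{\omega_j}\circ\dots\circ\varphi^{(j+q)}_{\omega_{j+q}}$, $j\ge 1$. For $\omega\in I^n$ write $\varphi_\omega=\varphi^{(1)}_{\omega_1}\circ\dots\circ\varphi^{(n)}_{\omega_n}$. The limit set is $J(\Phi)=\bigcap_{n\ge1}\bigcup_{\omega\in I^n}\varphi_\omega(X)$, and the lower pressure is $\underline P^{\Phi}(t)=\liminf_{n\to\infty}\frac1n\log\sum_{\omega\in I^n}\|D\varphi_\omega\|^t\in[-\infty,\infty]$ for $t\ge0$. Let $T:\Lambda\to\Lambda$ be an invertible (bimeasurable) ergodic transformation preserving a probability measure $m$, and for $\lambda\in\Lambda$ let $\{\varphi_i^\lambda:X\to X\}_{i\in I}$ be maps such that $\lambda\mapsto\varphi^\lambda_i(x)$ is measurable for all $i\in I$, $x\in X$, and such that for every $\lambda$ the sequence $\Phi_\lambda^{(n)}=\{\varphi_i^{T^n(\lambda)}\}_{i\in I}$, $n\ge1$, is an NCIFS $\Phi_\lambda$ (a *random conformal iterated function system*). If $I$ is infinite,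 assume moreover that $$\sup_{i\in I}\frac{\operatorname{ess\,sup}_{\lambda}\|D\varphi_i^\lambda\|}{\operatorname{ess\,inf}_{\lambda}\|D\varphi_i^\lambda\|}<\infty .$$ Let $\mathcal EP(t)$, the *expected pressure*, be the expected value of $\lambda\mapsto\underline P^{\Phi_\lambda}(t)$. Then for every $t\ge0$ one has $\underline P^{\Phi_\lambda}(t)=\mathcal EP(t)$ for almost every $\lambda$, and for almost every $\lambda$ the Hausdorff dimension of the limit set is $$\operatorname{HD}(J(\Phi_\lambda))=\inf\{t\ge0:\mathcal EP(t)\le0\}.$$ -/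

import Mathlib

open MeasureTheory Filter Set
open scoped ENNReal NNReal Topology

noncomputable section

/-- The frontier of `X` is a smooth embedded hypersurface: near each of its points it is a regular
level set. Only `C¹` is asked for, which covers every reading of "smooth". -/
def HasSmoothBoundary {d : ℕ} (X : Set (EuclideanSpace ℝ (Fin d))) : Prop :=
  ∀ x ∈ frontier X, ∃ (U : Set (EuclideanSpace ℝ (Fin d))) (f : EuclideanSpace ℝ (Fin d) → ℝ),
    IsOpen U ∧ x ∈ U ∧ ContDiffOn ℝ 1 f U ∧ fderiv ℝ f x ≠ 0 ∧
      frontier X ∩ U = {y ∈ U | f y = 0}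

/-- Uniform interior cone condition: every point of `X` is the vertex of an open cone, of fixed
opening angle and fixed size, contained in the interior of `X`. -/
def HasInteriorCones {d : ℕ} (X : Set (EuclideanSpace ℝ (Fin d))) : Prop :=
  ∃ c l : ℝ, 0 < c ∧ c < 1 ∧ 0 < l ∧ ∀ x ∈ X, ∃ u : EuclideanSpace ℝ (Fin d), ‖u‖ = 1 ∧
    ∀ y, ‖y - x‖ < l → c * ‖y - x‖ < inner ℝ (y - x) u → y ∈ interior X

/-- The standing assumptions on the set `X ⊆ ℝ^d` on which the systems act. -/
structure IsPhaseSpace {d : ℕ} (X : Set (EuclideanSpace ℝ (Fin d))) : Prop where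
  nonempty : X.Nonempty
  isCompact : IsCompact X
  closure_interior : closure (interior X) = X
  geometry : HasSmoothBoundary X ∨ Convex ℝ X ∨ HasInteriorCones X

/-- `wordMap φ n k ω = φ_{ω₀}^{(k)} ∘ φ_{ω₁}^{(k+1)} ∘ ⋯ ∘ φ_{ω_{n-1}}^{(k+n-1)}`, the map of a word
of `n` letters that starts at level `k`. -/
def wordMap {I E : Type*} (φ : ℕ → I → E → E) : (n : ℕ) → ℕ → (Fin n → I) → E → E
  | 0, _, _ => id
  | n + 1, k, ω => φ k (ω 0) ∘ wordMap φ n (k + 1) (Fin.tail ω)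

/-- `‖Df‖ = sup {|f'(x)| : x ∈ X}` for a map `f` of `X`. -/
def derivNorm {E : Type*} [NormedAddCommGroup E] [NormedSpace ℝ E] (X : Set E) (f : E → E) :
    ℝ≥0∞ :=
  ⨆ x ∈ X, ‖fderivWithin ℝ f X x‖ₑ

/-- `φ` is a non-autonomous conformal iterated function system on `X`. The levels are
`j = 1, 2, 3, …` (the value of `φ` at level `0` is irrelevant), all with the alphabet `I`, and only
the restrictions of the maps `φ j i` to `X` matter. -/
structure IsNCIFS {d : ℕ} {I : Type*} (X : Set (EuclideanSpace ℝ (Fin d)))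
    (φ : ℕ → I → EuclideanSpace ℝ (Fin d) → EuclideanSpace ℝ (Fin d)) : Prop where
  mapsTo : ∀ j, 1 ≤ j → ∀ i, MapsTo (φ j i) X X
  /-- open set condition -/
  disjoint_images : ∀ j, 1 ≤ j → ∀ a b, a ≠ b →
    Disjoint (φ j a '' interior X) (φ j b '' interior X)
  /-- The maps extend to `C¹` conformal diffeomorphisms `ψ j i` of an open connected set `V ⊇ X`
  into itself, and the compositions of the extensions have bounded distortion on `V`. -/
  conformal_distortion : ∃ (V : Set (EuclideanSpace ℝ (Fin d)))
      (ψ : ℕ → I → EuclideanSpace ℝ (Fin d) → EuclideanSpace ℝ (Fin d)),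
    IsOpen V ∧ IsConnected V ∧ X ⊆ V ∧
    (∀ j, 1 ≤ j → ∀ i, EqOn (ψ j i) (φ j i) X ∧ MapsTo (ψ j i) V V ∧ InjOn (ψ j i) V ∧
      ContDiffOn ℝ 1 (ψ j i) V ∧ ∀ x ∈ V, ConformalAt (ψ j i) x) ∧
    ∃ K : ℝ, 1 ≤ K ∧ ∀ n k, 1 ≤ k → ∀ ω : Fin n → I, ∀ x ∈ V, ∀ y ∈ V,
      ‖fderiv ℝ (wordMap ψ n k ω) x‖ ≤ K * ‖fderiv ℝ (wordMap ψ n k ω) y‖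
  /-- uniform contraction -/
  contraction : ∃ η : ℝ, 0 < η ∧ η < 1 ∧ ∃ M : ℕ, ∀ m, M ≤ m → ∀ k, 1 ≤ k →
    ∀ ω : Fin (m + 1) → I, ∀ x ∈ X, ‖fderivWithin ℝ (wordMap φ (m + 1) k ω) X x‖ ≤ η ^ m

/-- The limit set `J = ⋂_{n ≥ 1} ⋃_{ω ∈ I^n} φ_ω(X)`. -/
def limitSet {I E : Type*} (X : Set E) (φ : ℕ → I → E → E) : Set E :=
  ⋂ (n : ℕ) (_ : 1 ≤ n), ⋃ ω : Fin n → I, wordMap φ n 1 ω '' X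

/-- `Z_n(t) = ∑_{ω ∈ I^n} ‖Dφ_ω‖^t`. -/
def partitionSum {I E : Type*} [NormedAddCommGroup E] [NormedSpace ℝ E] (X : Set E)
    (φ : ℕ → I → E → E) (n : ℕ) (t : ℝ≥0) : ℝ≥0∞ :=
  ∑' ω : Fin n → I, derivNorm X (wordMap φ n 1 ω) ^ (t : ℝ)

/-- The lower pressure `liminf_n (1/n) log Z_n(t) ∈ [-∞, ∞]`. -/
def lowerPressure {I E : Type*} [NormedAddCommGroup E] [NormedSpace ℝ E] (X : Set E)
    (φ : ℕ → I → E → E) (t : ℝ≥0) : EReal :=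
  liminf (fun n : ℕ => ((1 / (n : ℝ) : ℝ) : EReal) * ENNReal.log (partitionSum X φ n t)) atTop

/-- The non-autonomous system `Φ_lam`, whose `n`-th level is `{φ_i^{T^n(lam)} : i ∈ I}`. -/
def fiberSystem {Λ I E : Type*} (T : Λ → Λ) (φ : Λ → I → E → E) (lam : Λ) : ℕ → I → E → E :=
  fun n i => φ (T^[n] lam) i

/-- `φ = (φ_i^lam)` is a random conformal iterated function system on `X` over the invertible
ergodic base `T`. -/
structure IsRandomCIFS {d : ℕ} {Λ I : Type*} [MeasurableSpace Λ]
    (X : Set (EuclideanSpace ℝ (Fin d))) (m : Measure Λ) (T : Λ ≃ᵐ Λ)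
    (φ : Λ → I → EuclideanSpace ℝ (Fin d) → EuclideanSpace ℝ (Fin d)) : Prop where
  ergodic : Ergodic (T : Λ → Λ) m
  measurable : ∀ i, ∀ x ∈ X, Measurable fun lam => φ lam i x
  isNCIFS : ∀ lam, IsNCIFS X (fiberSystem T φ lam)

/-- The expected value of an extended real valued random variable. -/
def erealExpectation {Λ : Type*} [MeasurableSpace Λ] (m : Measure Λ) (f : Λ → EReal) : EReal :=
  ((∫⁻ lam, (f lam).toENNReal ∂m : ℝ≥0∞) : EReal) -
    ((∫⁻ lam, (-f lam).toENNReal ∂m : ℝ≥0∞) : EReal)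

/-- The expected pressure: the expected value of the lower pressure of `Φ_lam`. -/
def expectedPressure {Λ I E : Type*} [MeasurableSpace Λ] [NormedAddCommGroup E] [NormedSpace ℝ E]
    (X : Set E) (m : Measure Λ) (T : Λ → Λ) (φ : Λ → I → E → E) (t : ℝ≥0) : EReal :=
  erealExpectation m fun lam => lowerPressure X (fiberSystem T φ lam) t

end

/-! The core is Bowen's formula for one fibre: the dimension of the limit set is the infimum of the
`t` with lower pressure `P(t) ≤ 0`. Ergodicity then makes the pressure the same for almost all
fibres. Write `Z_n(t)` for the sum of `‖Dφ_ω‖^t` over words of length `n` (`levelSum` from level 1).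

Upper bound (`dimH_limitSet_le`). The pieces `φ_ω(X)` with `|ω| = n` cover the limit set and have
diameter at most `L ‖Dφ_ω‖`. If `P(t) ≤ 0` and `s > t`, uniform contraction keeps `Z_n(s)` bounded
along infinitely many `n`, so the `s`-dimensional Hausdorff measure is finite.

Lower bound, finite alphabet (`le_dimH_limitSet_of_finite`). Conformality, bounded distortion and
interior cones bound the number of words of a given length with `‖Dφ_τ‖ > r` whose pieces meet a
ball of radius `r` (`exists_card_le`). Give `ω` the weight `‖Dφ_ω‖^t / Z_n(t)` and cut each word
meeting the ball at the first length where its norm is at most `r`. By quasi-multiplicativity of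
`Z`, the words cut at length `k` weigh at most a constant times `r^t / Z_k(t)`. If `P(t) > 0`, then
`∑ 1 / Z_k(t)` converges and the ball has mass at most `C r^t` (`exists_ball_mass_le`). The limit
set is compact, so finite covers suffice and no limit measure is needed.

Lower bound, infinite alphabet (`le_dimH_limitSet_of_comparable`). Almost surely each letter `i` has
a size `a i` independent of the level up to a bounded factor. If `∑ a_i^t = ∞`, a finite set of
letters already has positive pressure. Otherwise letters outside a large finite set `F` can be
replaced by one letter of `F` at a cost of a factor close to 1 per position, so positive pressure
passes to `F`.

Randomness. Up to constants, `Z_{n+1}` at `lam` is `Z_1` at `lam` times `Z_n` at `T lam`. Hence the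
pressure is measurable and almost surely invariant, so almost surely constant, and the constant is
its expectation. The exceptional null set depends on `t`; rational `t` and monotonicity remove this
dependence. -/

/-- Every point `z` of `X` is the vertex of a cone `⋃ s ∈ (0, 1], B(z + s u, s ρ)` over a ball of
fixed radius `ρ`, contained in the interior of `X`. -/
def HasFatCones {E : Type*} [NormedAddCommGroup E] [NormedSpace ℝ E] (X : Set E) : Prop :=
  ∃ ρ : ℝ, 0 < ρ ∧ ∀ z ∈ X, ∃ u : E, ∀ s : ℝ, 0 < s → s ≤ 1 →
    Metric.ball (z + s • u) (s * ρ) ⊆ interior X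

/-! ### Interior cones for the three kinds of phase space -/

section Geometry

/-- Off the frontier the space splits into two disjoint open sets, `interior X` and the complement
of `closure X`; a connected set stays in one of them. -/
lemma IsPreconnected.subset_interior_of_disjoint_frontier {E : Type*} [TopologicalSpace E]
    {X S : Set E} (hS : IsPreconnected S)
    (hne : (S ∩ interior X).Nonempty) (hd : Disjoint S (frontier X)) : S ⊆ interior X := by
  have hcov : S ⊆ interior X ∪ (closure X)ᶜ := by
    intro y hy
    by_cases h : y ∈ closure X
    · left
      by_contra h'
      exact hd.le_bot ⟨hy, h, h'⟩
    · exact Or.inr h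
  refine hS.subset_left_of_subset_union isOpen_interior isClosed_closure.isOpen_compl ?_ hcov hne
  exact disjoint_compl_right.mono_left (interior_subset.trans subset_closure)

variable {E : Type*} [NormedAddCommGroup E] [NormedSpace ℝ E] {X : Set E}

/-- The homothety with centre `z` and ratio `s` carries a fixed ball inside `X` to the ball required
at parameter `s`. -/
lemma Convex.hasFatCones (hX : Convex ℝ X) (hne : (interior X).Nonempty) : HasFatCones X := by
  obtain ⟨p, hp⟩ := hne
  obtain ⟨ρ, hρ, hball⟩ := Metric.isOpen_iff.1 isOpen_interior p hp
  refine ⟨ρ, hρ, fun z hz => ⟨p - z, fun s hs hs1 y hy => ?_⟩⟩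
  have hq : p + s⁻¹ • (y - (z + s • (p - z))) ∈ interior X := by
    apply hball
    rw [Metric.mem_ball, dist_eq_norm] at hy ⊢
    rw [add_sub_cancel_left, norm_smul, norm_inv, Real.norm_of_nonneg hs.le,
      inv_mul_lt_iff₀ hs]
    exact hy
  have := hX.combo_self_interior_mem_interior hz hq (a := 1 - s) (b := s) (by linarith) hs (by ring)
  convert this using 1
  rw [smul_add, smul_smul, mul_inv_cancel₀ hs.ne']
  module

lemma HasInteriorCones.hasFatCones {d : ℕ} {X : Set (EuclideanSpace ℝ (Fin d))}
    (hX : HasInteriorCones X) : HasFatCones X := by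
  obtain ⟨c, l, hc, hc1, hl, h⟩ := hX
  refine ⟨l / 2 * (1 - c) / (1 + c), by have : 0 < 1 - c := by linarith
                                        positivity, fun z hz => ?_⟩
  obtain ⟨u, hu, hcone⟩ := h z hz
  -- The solution of `l/2 - ρ = c (l/2 + ρ)`: the largest ball about the point at height `l/2` on
  -- the axis for which the two norm estimates below still give the cone inequality.
  set ρ := l / 2 * (1 - c) / (1 + c) with hρ
  have hρc : ρ * (1 + c) = l / 2 * (1 - c) := by rw [hρ]; field_simp
  refine ⟨(l / 2) • u, fun s hs hs1 y hy => ?_⟩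
  rw [Metric.mem_ball, dist_eq_norm] at hy
  set w := y - (z + s • (l / 2) • u) with hw
  have hyz : y - z = (s * (l / 2)) • u + w := by rw [hw, smul_smul]; abel
  have hnorm : ‖y - z‖ ≤ s * (l / 2) + ‖w‖ := by
    rw [hyz]
    refine (norm_add_le _ _).trans ?_
    rw [norm_smul, hu, Real.norm_of_nonneg (by positivity), mul_one]
  have hinner : s * (l / 2) - ‖w‖ ≤ inner ℝ (y - z) u := by
    rw [hyz, inner_add_left, real_inner_smul_left, real_inner_self_eq_norm_sq, hu]
    have := (abs_le.1 (abs_real_inner_le_norm w u)).1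
    rw [hu] at this
    linarith
  have hρl : ρ < l / 2 := by nlinarith
  apply hcone
  · nlinarith
  · nlinarith [mul_le_mul_of_nonneg_left hnorm hc.le]

/-- Shrinking `ρ` preserves the property, so by compactness the minimum of finitely many local radii
works everywhere. -/
lemma hasFatCones_of_local (hX : IsCompact X)
    (h : ∀ x ∈ X, ∃ ρ : ℝ, 0 < ρ ∧ ∀ᶠ z in 𝓝[X] x, ∃ u : E, ∀ s : ℝ, 0 < s → s ≤ 1 →
      Metric.ball (z + s • u) (s * ρ) ⊆ interior X) : HasFatCones X := by
  refine hX.induction_on (p := fun S => ∃ ρ : ℝ, 0 < ρ ∧ ∀ z ∈ S, ∃ u : E, ∀ s : ℝ, 0 < s → s ≤ 1 →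
    Metric.ball (z + s • u) (s * ρ) ⊆ interior X) ⟨1, one_pos, by simp⟩ ?_ ?_ ?_
  · rintro S S' hS ⟨ρ, hρ, h'⟩
    exact ⟨ρ, hρ, fun z hz => h' z (hS hz)⟩
  · rintro S S' ⟨ρ, hρ, h1⟩ ⟨ρ', hρ', h2⟩
    refine ⟨min ρ ρ', lt_min hρ hρ', fun z hz => ?_⟩
    rcases hz with hz | hz
    · obtain ⟨u, hu⟩ := h1 z hz
      refine ⟨u, fun s hs hs1 => (Metric.ball_subset_ball ?_).trans (hu s hs hs1)⟩
      gcongr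
      exact min_le_left _ _
    · obtain ⟨u, hu⟩ := h2 z hz
      refine ⟨u, fun s hs hs1 => (Metric.ball_subset_ball ?_).trans (hu s hs hs1)⟩
      gcongr
      exact min_le_right _ _
  · intro x hx
    obtain ⟨ρ, hρ, h'⟩ := h x hx
    exact ⟨_, h', ρ, hρ, fun z hz => hz⟩

/-- One side of a regular level set: if `f` vanishes exactly on the frontier of `X` near `x` and is
positive at some interior points of `X` close to `x`, then all points near `x` with `0 ≤ f` are
vertices of fat cones. -/
lemma eventually_fatCone_of_regular {x : E} {U : Set E} {f : E → ℝ} {f' : E →L[ℝ] ℝ}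
    (hU : U ∈ 𝓝 x) (hfr : ∀ y ∈ U, y ∈ frontier X → f y = 0)
    (hf : HasStrictFDerivAt f f' x) (hf' : f' ≠ 0) :
    ∃ ρ : ℝ, 0 < ρ ∧ ∃ W ∈ 𝓝 x, ∀ p ∈ W, p ∈ interior X → 0 < f p →
      ∀ z ∈ W, 0 ≤ f z → ∃ u : E, ∀ s : ℝ, 0 < s → s ≤ 1 →
        Metric.ball (z + s • u) (s * ρ) ⊆ interior X := by
  obtain ⟨v, hv⟩ : ∃ v, f' v = 1 := by
    obtain ⟨w, hw⟩ : ∃ w, f' w ≠ 0 := by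
      by_contra! h
      exact hf' (ContinuousLinearMap.ext h)
    exact ⟨(f' w)⁻¹ • w, by simp [hw]⟩
  set M := ‖f'‖ with hM
  have hMpos : 0 < M := norm_pos_iff.2 hf'
  set A := ‖v‖ with hA
  have hApos : 0 < A := norm_pos_iff.2 (by rintro rfl; simp at hv)
  -- growth of `f` in directions close to `v`
  have hev := (hf.isLittleO.def (show 0 < 1 / (4 * (A + 1)) by positivity))
  rw [nhds_prod_eq] at hev
  obtain ⟨U₁, hU₁, hsq⟩ := mem_prod_self_iff.1 hev
  have hgrow : ∀ y ∈ U₁, ∀ z ∈ U₁, ‖f y - f z - f' (y - z)‖ ≤ 1 / (4 * (A + 1)) * ‖y - z‖ :=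
    fun y hy z hz => hsq (mk_mem_prod hy hz)
  obtain ⟨R, hR, hRU⟩ := Metric.mem_nhds_iff.1 (Filter.inter_mem hU hU₁)
  -- radius of the balls relative to `‖v‖`
  set κ := min 1 (1 / (4 * M)) with hκ
  have hκpos : 0 < κ := by positivity
  have hκ1 : κ ≤ 1 := min_le_left _ _
  have hκM : κ * M ≤ 1 / 4 := by
    calc κ * M ≤ 1 / (4 * M) * M := by gcongr; exact min_le_right _ _
      _ = 1 / 4 := by field_simp
  set δ := R / (2 * (A + 1)) with hδ
  have hδpos : 0 < δ := by positivity
  have hδA : δ * (A + 1) = R / 2 := by rw [hδ]; field_simp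
  -- Moving by `s • v` raises `f` by `s` to first order. The deviation `w` and the linearisation
  -- error cost at most `s/4` each, by the choice of `κ` and of `1 / (4 * (A + 1))`.
  have key : ∀ z ∈ Metric.ball x (R / 2), ∀ s, 0 < s → s ≤ δ → ∀ w : E, ‖w‖ < s * κ →
      z + (s • v + w) ∈ Metric.ball x R ∧ f z < f (z + (s • v + w)) := by
    intro z hz s hs hsδ w hw
    have hlen : ‖s • v + w‖ ≤ s * (A + 1) := by
      calc ‖s • v + w‖ ≤ s * A + ‖w‖ := by
            refine (norm_add_le _ _).trans ?_
            rw [norm_smul, Real.norm_of_nonneg hs.le]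
        _ ≤ s * (A + 1) := by nlinarith
    have hmem : z + (s • v + w) ∈ Metric.ball x R := by
      rw [Metric.mem_ball, dist_eq_norm] at hz ⊢
      calc ‖z + (s • v + w) - x‖ = ‖(z - x) + (s • v + w)‖ := by congr 1; abel
        _ ≤ ‖z - x‖ + ‖s • v + w‖ := norm_add_le _ _
        _ < R / 2 + δ * (A + 1) := by
            refine add_lt_add_of_lt_of_le hz (hlen.trans ?_)
            gcongr
        _ = R := by rw [hδA]; ring
    refine ⟨hmem, ?_⟩
    have hz' : z ∈ Metric.ball x R := Metric.ball_subset_ball (by linarith) hz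
    have h1 := hgrow _ (hRU hmem).2 _ (hRU hz').2
    simp only [add_sub_cancel_left, map_add, map_smul, hv, smul_eq_mul, mul_one] at h1
    have h2 : |f' w| ≤ M * ‖w‖ := f'.le_opNorm w
    have h3 : 1 / (4 * (A + 1)) * ‖s • v + w‖ ≤ s / 4 := by
      calc 1 / (4 * (A + 1)) * ‖s • v + w‖ ≤ 1 / (4 * (A + 1)) * (s * (A + 1)) := by gcongr
        _ = s / 4 := by field_simp
    have h4 : M * ‖w‖ ≤ s / 4 := by
      calc M * ‖w‖ ≤ M * (s * κ) := by gcongr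
        _ = s * (κ * M) := by ring
        _ ≤ s * (1 / 4) := by gcongr
        _ = s / 4 := by ring
    have h5 := (abs_le.1 ((Real.norm_eq_abs _ ▸ h1).trans h3)).1
    have h6 := (abs_le.1 (h2.trans h4)).1
    linarith
  have hray : ∀ S : Set E, IsPreconnected S → S ⊆ Metric.ball x R → (∀ y ∈ S, 0 < f y) →
      (S ∩ interior X).Nonempty → S ⊆ interior X := by
    intro S hS hSR hpos hne
    refine hS.subset_interior_of_disjoint_frontier hne ?_
    rw [Set.disjoint_left]
    intro y hy hyf
    exact (hpos y hy).ne' (hfr y (hRU (hSR hy)).1 hyf)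
  -- Two points of the `r`-ball are less than `δ * κ` apart, so the top `p + δ • v` of the segment
  -- over `p` lies in the cone over `z`.
  set r := min (R / 2) (δ * κ / 4) with hr
  have hrpos : 0 < r := by positivity
  refine ⟨δ * κ, by positivity, Metric.ball x r, Metric.ball_mem_nhds x hrpos, ?_⟩
  intro p hp hpi hfp z hz hfz
  have hsub : Metric.ball x r ⊆ Metric.ball x (R / 2) := Metric.ball_subset_ball (min_le_left _ _)
  -- the set of points above `p` and `z`
  have hcone : ∀ q ∈ Metric.ball x (R / 2), 0 ≤ f q → ∀ w : E, ‖w‖ < κ → ∀ s, 0 < s → s ≤ δ →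
      q + s • (v + w) ∈ Metric.ball x R ∧ 0 < f (q + s • (v + w)) := by
    intro q hq hfq w hw s hs hsδ
    have := key q hq s hs hsδ (s • w) (by
      rw [norm_smul, Real.norm_of_nonneg hs.le]; gcongr)
    rw [← smul_add] at this
    exact ⟨this.1, hfq.trans_lt this.2⟩
  have hpz : ‖p - z‖ < δ * κ := by
    rw [← dist_eq_norm]
    have h1 : dist p z < r + r := by
      calc dist p z ≤ dist p x + dist z x := dist_triangle_right _ _ _
        _ < r + r := add_lt_add hp hz
    have h2 : r ≤ δ * κ / 4 := min_le_right _ _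
    have h3 : 0 < δ * κ := by positivity
    linarith
  have hpc : p + δ • v ∈ interior X := by
    have hseg : (fun s : ℝ => p + s • v) '' Icc 0 δ ⊆ interior X := by
      refine hray _ ((isPreconnected_Icc).image _ (by fun_prop)) ?_ ?_
        ⟨p, ⟨0, ⟨le_rfl, hδpos.le⟩, by simp⟩, hpi⟩
      · rintro _ ⟨s, hs, rfl⟩
        rcases hs.1.eq_or_lt with h | h
        · simpa [← h] using Metric.ball_subset_ball (by linarith) (hsub hp)
        · simpa using (hcone p (hsub hp) hfp.le 0 (by simpa) s h hs.2).1
      · rintro _ ⟨s, hs, rfl⟩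
        rcases hs.1.eq_or_lt with h | h
        · simpa [← h] using hfp
        · simpa using (hcone p (hsub hp) hfp.le 0 (by simpa) s h hs.2).2
    exact hseg ⟨δ, ⟨hδpos.le, le_rfl⟩, rfl⟩
  -- The cone over `z` is connected, `f` is positive on it, and it contains the interior point `p +
  -- δ • v`; so it cannot cross the frontier.
  set C : Set E := (fun y : ℝ × E => z + y.1 • (v + y.2)) '' (Ioc 0 δ ×ˢ Metric.ball 0 κ) with hC
  have hCsub : C ⊆ interior X := by
    refine hray C ?_ ?_ ?_ ?_
    · refine IsPreconnected.image ?_ _ (by fun_prop)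
      exact isPreconnected_Ioc.prod (convex_ball 0 κ).isPreconnected
    · rintro _ ⟨⟨s, w⟩, ⟨hs, hw⟩, rfl⟩
      exact (hcone z (hsub hz) hfz w (by simpa using hw) s hs.1 hs.2).1
    · rintro _ ⟨⟨s, w⟩, ⟨hs, hw⟩, rfl⟩
      exact (hcone z (hsub hz) hfz w (by simpa using hw) s hs.1 hs.2).2
    · refine ⟨p + δ • v, ⟨(δ, δ⁻¹ • (p - z)), ⟨⟨hδpos, le_rfl⟩, ?_⟩, ?_⟩, hpc⟩
      · rw [mem_ball_zero_iff, norm_smul, norm_inv, Real.norm_of_nonneg hδpos.le,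
          inv_mul_lt_iff₀ hδpos]
        exact hpz
      · simp only [smul_add, smul_smul, mul_inv_cancel₀ hδpos.ne', one_smul]
        abel
  refine ⟨δ • v, fun s hs hs1 y hy => hCsub ⟨(s * δ, (s * δ)⁻¹ • (y - (z + s • δ • v))),
    ⟨⟨by positivity, mul_le_of_le_one_left hδpos.le hs1⟩, ?_⟩, ?_⟩⟩
  · rw [Metric.mem_ball, dist_eq_norm] at hy
    rw [mem_ball_zero_iff, norm_smul, norm_inv, Real.norm_of_nonneg (by positivity),
      inv_mul_lt_iff₀ (by positivity)]
    rwa [mul_assoc]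
  · have : s * δ ≠ 0 := by positivity
    simp only [smul_add, smul_smul, mul_inv_cancel₀ this, one_smul]
    abel

/-- Near a frontier point `X` may lie on one side of the level set or on both. A point off the level
set is interior and decides its own side. A point on it is a vertex for either side, so a nearby
interior point `p`, supplied by `closure (interior X) = X`, chooses the side. -/
lemma HasSmoothBoundary.hasFatCones {d : ℕ} {X : Set (EuclideanSpace ℝ (Fin d))}
    (hX : HasSmoothBoundary X) (hc : IsCompact X) (hcl : closure (interior X) = X) :
    HasFatCones X := by
  refine hasFatCones_of_local hc fun x hx => ?_
  by_cases hxi : x ∈ interior X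
  · obtain ⟨R, hR, hball⟩ := Metric.isOpen_iff.1 isOpen_interior x hxi
    refine ⟨R / 2, by positivity, ?_⟩
    filter_upwards [mem_nhdsWithin_of_mem_nhds (Metric.ball_mem_nhds x (half_pos hR))] with z hz
    refine ⟨0, fun s hs hs1 y hy => hball ?_⟩
    simp only [smul_zero, add_zero, Metric.mem_ball] at hy hz ⊢
    have := dist_triangle y z x
    nlinarith
  · have hxf : x ∈ frontier X := ⟨subset_closure hx, hxi⟩
    obtain ⟨U, f, hU, hxU, hf, hf', hfr⟩ := hX x hxf
    have hfx : HasStrictFDerivAt f (fderiv ℝ f x) x :=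
      (hf.contDiffAt (hU.mem_nhds hxU)).hasStrictFDerivAt one_ne_zero
    have hfr' : ∀ y ∈ U, (y ∈ frontier X ↔ f y = 0) := by
      intro y hy
      have : y ∈ frontier X ∩ U ↔ y ∈ {y ∈ U | f y = 0} := by rw [hfr]
      simpa [hy] using this
    obtain ⟨ρ₁, hρ₁, W₁, hW₁, h₁⟩ := eventually_fatCone_of_regular (X := X) (hU.mem_nhds hxU)
      (fun y hy h => (hfr' y hy).1 h) hfx hf'
    obtain ⟨ρ₂, hρ₂, W₂, hW₂, h₂⟩ := eventually_fatCone_of_regular (X := X) (f := fun y => -f y)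
      (hU.mem_nhds hxU) (fun y hy h => by simpa using (hfr' y hy).1 h) hfx.neg (neg_ne_zero.2 hf')
    have hW : U ∩ (W₁ ∩ W₂) ∈ 𝓝 x :=
      Filter.inter_mem (hU.mem_nhds hxU) (Filter.inter_mem hW₁ hW₂)
    refine ⟨min ρ₁ ρ₂, lt_min hρ₁ hρ₂, ?_⟩
    have hmono : ∀ ρ, min ρ₁ ρ₂ ≤ ρ → ∀ z : EuclideanSpace ℝ (Fin d),
        (∃ u, ∀ s : ℝ, 0 < s → s ≤ 1 → Metric.ball (z + s • u) (s * ρ) ⊆ interior X) →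
        ∃ u, ∀ s : ℝ, 0 < s → s ≤ 1 →
          Metric.ball (z + s • u) (s * min ρ₁ ρ₂) ⊆ interior X := by
      rintro ρ hρ z ⟨u, hu⟩
      refine ⟨u, fun s hs hs1 => (Metric.ball_subset_ball ?_).trans (hu s hs hs1)⟩
      gcongr
    obtain ⟨p, hpW, hpi⟩ := mem_closure_iff_nhds.1 (hcl.symm ▸ hx : x ∈ closure (interior X)) _ hW
    have hnf : ∀ q ∈ U, q ∈ interior X → f q ≠ 0 := by
      intro q hq hqi h0
      exact ((hfr' q hq).2 h0).2 hqi
    filter_upwards [mem_nhdsWithin_of_mem_nhds hW, self_mem_nhdsWithin] with z hz hzX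
    rcases lt_trichotomy (f z) 0 with h | h | h
    · have hzi : z ∈ interior X := by
        by_contra h'
        exact h.ne ((hfr' z hz.1).1 ⟨subset_closure hzX, h'⟩)
      exact hmono ρ₂ (min_le_right _ _) z
        (h₂ z hz.2.2 hzi (by simpa using h) z hz.2.2 (by simpa using h.le))
    · rcases (hnf p hpW.1 hpi).lt_or_gt with hp | hp
      · exact hmono ρ₂ (min_le_right _ _) z
          (h₂ p hpW.2.2 hpi (by simpa using hp) z hz.2.2 (by simp [h]))
      · exact hmono ρ₁ (min_le_left _ _) z (h₁ p hpW.2.1 hpi hp z hz.2.1 h.ge)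
    · have hzi : z ∈ interior X := by
        by_contra h'
        exact h.ne' ((hfr' z hz.1).1 ⟨subset_closure hzX, h'⟩)
      exact hmono ρ₁ (min_le_left _ _) z (h₁ z hz.2.1 hzi h z hz.2.1 h.le)

lemma IsPhaseSpace.interior_nonempty {d : ℕ} {X : Set (EuclideanSpace ℝ (Fin d))}
    (hX : IsPhaseSpace X) : (interior X).Nonempty := by
  rw [← closure_nonempty_iff, hX.closure_interior]
  exact hX.nonempty

lemma IsPhaseSpace.hasFatCones {d : ℕ} {X : Set (EuclideanSpace ℝ (Fin d))}
    (hX : IsPhaseSpace X) : HasFatCones X := by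
  rcases hX.geometry with h | h | h
  · exact h.hasFatCones hX.isCompact hX.closure_interior
  · exact h.hasFatCones hX.interior_nonempty
  · exact h.hasFatCones

/-- The convex hull of the vertex and the base of a fat cone. -/
lemma convexHull_fatCone_subset {z u : E} {ρ : ℝ} (hρ : 0 < ρ) (hz : z ∈ X)
    (hu : ∀ s : ℝ, 0 < s → s ≤ 1 → Metric.ball (z + s • u) (s * ρ) ⊆ interior X) :
    convexHull ℝ (insert z (Metric.ball (z + u) ρ)) ⊆ X := by
  have hne : (Metric.ball (z + u) ρ).Nonempty := ⟨_, Metric.mem_ball_self hρ⟩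
  rw [convexHull_insert hne, (convex_ball _ _).convexHull_eq]
  intro y hy
  simp only [mem_convexJoin, mem_singleton_iff, exists_eq_left] at hy
  obtain ⟨q, hq, a, s, ha, hs, has, rfl⟩ := hy
  rcases hs.eq_or_lt with rfl | hs'
  · have : a = 1 := by linarith
    simpa [this] using hz
  · refine interior_subset (hu s hs' (by linarith) ?_)
    rw [Metric.mem_ball, dist_eq_norm] at hq ⊢
    have : a • z + s • q - (z + s • u) = s • (q - (z + u)) := by
      rw [show a = 1 - s by linarith]
      module
    rw [this, norm_smul, Real.norm_of_nonneg hs]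
    gcongr

lemma ball_subset_convexHull_fatCone {z u : E} {ρ s : ℝ} (hs : 0 < s) (hs1 : s ≤ 1) :
    Metric.ball (z + s • u) (s * ρ) ⊆ convexHull ℝ (insert z (Metric.ball (z + u) ρ)) := by
  intro y hy
  have hq : z + u + s⁻¹ • (y - (z + s • u)) ∈ Metric.ball (z + u) ρ := by
    rw [Metric.mem_ball, dist_eq_norm] at hy ⊢
    rw [add_sub_cancel_left, norm_smul, norm_inv, Real.norm_of_nonneg hs.le,
      inv_mul_lt_iff₀ hs]
    exact hy
  have := convex_convexHull ℝ (insert z (Metric.ball (z + u) ρ))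
    (subset_convexHull ℝ _ (mem_insert _ _)) (subset_convexHull ℝ _ (mem_insert_of_mem _ hq))
    (sub_nonneg.2 hs1) hs.le (by ring)
  convert this using 1
  rw [smul_add, smul_smul, mul_inv_cancel₀ hs.ne']
  module

/-- Each point lies in a convex subset of `X` with nonempty interior. This makes `fderivWithin` on
`X` the derivative of any differentiable extension, also at frontier points. -/
lemma HasFatCones.uniqueDiffOn (hX : HasFatCones X) : UniqueDiffOn ℝ X := by
  obtain ⟨ρ, hρ, h⟩ := hX
  intro z hz
  obtain ⟨u, hu⟩ := h z hz
  have hne : (Metric.ball (z + u) ρ).Nonempty := ⟨_, Metric.mem_ball_self hρ⟩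
  refine (uniqueDiffWithinAt_convex (convex_convexHull ℝ _) ?_
    (subset_closure (subset_convexHull ℝ _ (mem_insert _ _)))).mono
    (convexHull_fatCone_subset hρ hz hu)
  exact (hne.mono (interior_maximal ((subset_insert _ _).trans (subset_convexHull ℝ _))
    Metric.isOpen_ball))

end Geometry

/-! ### Conformal linear maps: multiplicative norms and determinants -/

section ConformalMaps

variable {E : Type*} [NormedAddCommGroup E] [InnerProductSpace ℝ E]

lemma ConformalAt.isConformalMap_fderiv {f : E → E} {x : E} (hf : ConformalAt f x) :
    IsConformalMap (fderiv ℝ f x) := by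
  obtain ⟨f', h, h'⟩ := hf
  rwa [h.fderiv]

variable [Nontrivial E]

lemma IsConformalMap.norm_smul_isometry (c : ℝ) (li : E →ₗᵢ[ℝ] E) :
    ‖c • li.toContinuousLinearMap‖ = |c| := by
  rw [norm_smul, LinearIsometry.norm_toContinuousLinearMap, mul_one, Real.norm_eq_abs]

lemma IsConformalMap.norm_apply {L : E →L[ℝ] E} (hL : IsConformalMap L) (v : E) :
    ‖L v‖ = ‖L‖ * ‖v‖ := by
  obtain ⟨c, -, li, rfl⟩ := hL
  rw [norm_smul_isometry]
  simp [norm_smul]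

lemma IsConformalMap.norm_pos {L : E →L[ℝ] E} (hL : IsConformalMap L) : 0 < ‖L‖ := by
  obtain ⟨c, hc, li, rfl⟩ := hL
  rw [norm_smul_isometry]
  exact abs_pos.2 hc

/-- A conformal map scales all vectors by the same factor, so submultiplicativity of the operator
norm becomes equality. The lower multiplicative bound for word norms rests on this. -/
lemma IsConformalMap.norm_comp {L M : E →L[ℝ] E} (hL : IsConformalMap L) :
    ‖L.comp M‖ = ‖L‖ * ‖M‖ := by
  refine le_antisymm (L.opNorm_comp_le M) ?_
  rw [mul_comm, ← le_div_iff₀ hL.norm_pos]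
  refine M.opNorm_le_bound (by positivity) fun v => ?_
  rw [div_mul_eq_mul_div, le_div_iff₀ hL.norm_pos, mul_comm, ← hL.norm_apply]
  exact (L.comp M).le_opNorm v

lemma IsConformalMap.abs_det [FiniteDimensional ℝ E] {L : E →L[ℝ] E} (hL : IsConformalMap L) :
    |L.det| = ‖L‖ ^ Module.finrank ℝ E := by
  obtain ⟨c, -, li, rfl⟩ := hL
  rw [norm_smul_isometry]
  have h1 : |LinearMap.det (li.toLinearMap)| = 1 := by
    rw [← LinearMap.normDet_eq_abs_det, li.normDet_eq_one]
  have h2 : (c • li.toContinuousLinearMap).det = LinearMap.det (c • li.toLinearMap) := rfl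
  rw [h2, LinearMap.det_smul, abs_mul, h1, mul_one, abs_pow]

lemma ConformalAt.norm_fderiv_comp {f g : E → E} {x : E} (hf : ConformalAt f (g x))
    (hg : ConformalAt g x) :
    ‖fderiv ℝ (f ∘ g) x‖ = ‖fderiv ℝ f (g x)‖ * ‖fderiv ℝ g x‖ := by
  rw [fderiv_comp x hf.differentiableAt hg.differentiableAt, hf.isConformalMap_fderiv.norm_comp]

end ConformalMaps

/-! ### Words and their compositions -/

section Words

variable {I E : Type*}

lemma wordMap_append (φ : ℕ → I → E → E) {a b : ℕ} (k : ℕ) (ω : Fin a → I) (τ : Fin b → I) :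
    wordMap φ (a + b) k (Fin.append ω τ) = wordMap φ a k ω ∘ wordMap φ b (k + a) τ := by
  -- The length is freed from the form `a + b` so that the induction on `a` needs no casts between
  -- `Fin` types.
  suffices h : ∀ (a n k : ℕ) (hn : n = a + b) (ω : Fin n → I),
      wordMap φ n k ω = wordMap φ a k (fun i => ω ⟨i, by omega⟩) ∘
        wordMap φ b (k + a) (fun i => ω ⟨a + i, by omega⟩) by
    rw [h a (a + b) k rfl]
    congr 2
    · funext i
      exact Fin.append_left ω τ i
    · funext i
      exact Fin.append_right ω τ i
  intro a
  induction a with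
  | zero =>
    intro n k hn ω
    obtain rfl : n = b := by omega
    simp [wordMap]
  | succ a ih =>
    intro n k hn ω
    obtain ⟨n, rfl⟩ : ∃ n', n = n' + 1 := ⟨a + b, by omega⟩
    simp only [wordMap]
    rw [ih n (k + 1) (by omega), Function.comp_assoc]
    congr 2
    rw [show k + 1 + a = k + (a + 1) by omega]
    congr 2
    funext i
    simp only [Fin.tail]
    congr 1
    ext
    simp only [Fin.val_succ]
    omega

lemma wordMap_reindex {I' : Type*} (φ : ℕ → I → E → E) (e : I' → I) (n k : ℕ) (ω : Fin n → I') :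
    wordMap (fun j i => φ j (e i)) n k ω = wordMap φ n k (e ∘ ω) := by
  induction n generalizing k with
  | zero => rfl
  | succ n ih =>
    simp only [wordMap, ih]
    rfl

lemma wordMap_shift (φ : ℕ → I → E → E) (n k : ℕ) (ω : Fin n → I) :
    wordMap (fun j => φ (j + 1)) n k ω = wordMap φ n (k + 1) ω := by
  induction n generalizing k with
  | zero => rfl
  | succ n ih => simp only [wordMap, ih]

lemma mapsTo_wordMap {φ : ℕ → I → E → E} {X : Set E} (h : ∀ j, 1 ≤ j → ∀ i, MapsTo (φ j i) X X)
    {n k : ℕ} (hk : 1 ≤ k) (ω : Fin n → I) : MapsTo (wordMap φ n k ω) X X := by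
  induction n generalizing k with
  | zero => exact mapsTo_id X
  | succ n ih => exact (h k hk _).comp (ih (by omega) _)

end Words

/-! ### Conformal extensions and norms of words -/

/-- `ψ` is a family of conformal extensions of the maps `φ` to the open set `V ⊇ X`, with
distortion bounded by `K`. -/
structure IsConformalExtension {E I : Type*} [NormedAddCommGroup E] [InnerProductSpace ℝ E]
    (X : Set E) (φ : ℕ → I → E → E) (V : Set E) (ψ : ℕ → I → E → E) (K : ℝ≥0) : Prop where
  mapsTo_base : ∀ j, 1 ≤ j → ∀ i, MapsTo (φ j i) X X
  isOpen : IsOpen V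
  isConnected : IsConnected V
  subset : X ⊆ V
  eqOn : ∀ j, 1 ≤ j → ∀ i, EqOn (ψ j i) (φ j i) X
  mapsTo : ∀ j, 1 ≤ j → ∀ i, MapsTo (ψ j i) V V
  injOn : ∀ j, 1 ≤ j → ∀ i, InjOn (ψ j i) V
  contDiffOn : ∀ j, 1 ≤ j → ∀ i, ContDiffOn ℝ 1 (ψ j i) V
  conformalAt : ∀ j, 1 ≤ j → ∀ i, ∀ x ∈ V, ConformalAt (ψ j i) x
  one_le : 1 ≤ K
  distortion : ∀ n k, 1 ≤ k → ∀ ω : Fin n → I, ∀ x ∈ V, ∀ y ∈ V,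
    ‖fderiv ℝ (wordMap ψ n k ω) x‖ₑ ≤ K * ‖fderiv ℝ (wordMap ψ n k ω) y‖ₑ

lemma IsNCIFS.exists_extension {d : ℕ} {I : Type*} {X : Set (EuclideanSpace ℝ (Fin d))}
    {φ : ℕ → I → EuclideanSpace ℝ (Fin d) → EuclideanSpace ℝ (Fin d)} (h : IsNCIFS X φ) :
    ∃ V ψ K, IsConformalExtension X φ V ψ K := by
  obtain ⟨V, ψ, hV, hVc, hXV, hψ, K, hK, hdist⟩ := h.conformal_distortion
  refine ⟨V, ψ, K.toNNReal, h.mapsTo, hV, hVc, hXV, fun j hj i => (hψ j hj i).1,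
    fun j hj i => (hψ j hj i).2.1, fun j hj i => (hψ j hj i).2.2.1,
    fun j hj i => (hψ j hj i).2.2.2.1, fun j hj i => (hψ j hj i).2.2.2.2, ?_, ?_⟩
  · simpa using hK
  · intro n k hk ω x hx y hy
    rw [← ofReal_norm, ← ofReal_norm]
    change _ ≤ ENNReal.ofReal K * _
    rw [← ENNReal.ofReal_mul (by linarith)]
    exact ENNReal.ofReal_le_ofReal (hdist n k hk ω x hx y hy)

/-- `‖Dφ_ω‖` for a word `ω` of length `n` starting at level `k`. -/
noncomputable def wordNorm {E I : Type*} [NormedAddCommGroup E] [NormedSpace ℝ E] (X : Set E)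
    (φ : ℕ → I → E → E) (n k : ℕ) (ω : Fin n → I) : ℝ≥0∞ :=
  derivNorm X (wordMap φ n k ω)

/-- `∑_ω ‖Dφ_ω‖^t` over the words `ω` of length `n` starting at level `k`. -/
noncomputable def levelSum {E I : Type*} [NormedAddCommGroup E] [NormedSpace ℝ E] (X : Set E)
    (φ : ℕ → I → E → E) (n k : ℕ) (t : ℝ≥0) : ℝ≥0∞ :=
  ∑' ω : Fin n → I, wordNorm X φ n k ω ^ (t : ℝ)

namespace IsConformalExtension

variable {E I : Type*} [NormedAddCommGroup E] [InnerProductSpace ℝ E]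
  {X V : Set E} {φ ψ : ℕ → I → E → E} {K : ℝ≥0}

lemma mapsTo_word (h : IsConformalExtension X φ V ψ K) {n k : ℕ} (hk : 1 ≤ k) (ω : Fin n → I) :
    MapsTo (wordMap ψ n k ω) V V := mapsTo_wordMap h.mapsTo hk ω

lemma eqOn_word (h : IsConformalExtension X φ V ψ K) {n k : ℕ} (hk : 1 ≤ k) (ω : Fin n → I) :
    EqOn (wordMap ψ n k ω) (wordMap φ n k ω) X := by
  induction n generalizing k with
  | zero => exact fun x _ => rfl
  | succ n ih =>
    intro x hx
    simp only [wordMap, Function.comp_apply]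
    rw [ih (by omega) _ hx]
    exact h.eqOn k hk _ (mapsTo_wordMap h.mapsTo_base (by omega) _ hx)

lemma injOn_word (h : IsConformalExtension X φ V ψ K) {n k : ℕ} (hk : 1 ≤ k) (ω : Fin n → I) :
    InjOn (wordMap ψ n k ω) V := by
  induction n generalizing k with
  | zero => exact injOn_id V
  | succ n ih => exact (h.injOn k hk _).comp (ih (by omega) _) (h.mapsTo_word (by omega) _)

lemma contDiffOn_word (h : IsConformalExtension X φ V ψ K) {n k : ℕ} (hk : 1 ≤ k)
    (ω : Fin n → I) : ContDiffOn ℝ 1 (wordMap ψ n k ω) V := by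
  induction n generalizing k with
  | zero => exact contDiffOn_id
  | succ n ih => exact (h.contDiffOn k hk _).comp (ih (by omega) _) (h.mapsTo_word (by omega) _)

lemma conformalAt_word (h : IsConformalExtension X φ V ψ K) {n k : ℕ} (hk : 1 ≤ k)
    (ω : Fin n → I) {x : E} (hx : x ∈ V) : ConformalAt (wordMap ψ n k ω) x := by
  induction n generalizing k with
  | zero => exact conformalAt_id x
  | succ n ih =>
    exact (h.conformalAt k hk _ _ (h.mapsTo_word (by omega) _ hx)).comp x (ih (by omega) _)

lemma fderivWithin_word (h : IsConformalExtension X φ V ψ K) (hX : UniqueDiffOn ℝ X) {n k : ℕ}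
    (hk : 1 ≤ k) (ω : Fin n → I) {x : E} (hx : x ∈ X) :
    fderivWithin ℝ (wordMap φ n k ω) X x = fderiv ℝ (wordMap ψ n k ω) x := by
  rw [← fderivWithin_congr (h.eqOn_word hk ω) (h.eqOn_word hk ω hx)]
  exact (h.conformalAt_word hk ω (h.subset hx)).differentiableAt.fderivWithin (hX x hx)

lemma wordNorm_eq (h : IsConformalExtension X φ V ψ K) (hX : UniqueDiffOn ℝ X) {n k : ℕ}
    (hk : 1 ≤ k) (ω : Fin n → I) :
    wordNorm X φ n k ω = ⨆ x ∈ X, ‖fderiv ℝ (wordMap ψ n k ω) x‖ₑ :=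
  biSup_congr fun x hx => by rw [h.fderivWithin_word hX hk ω hx]

lemma enorm_fderiv_le (h : IsConformalExtension X φ V ψ K) (hX : UniqueDiffOn ℝ X) {n k : ℕ}
    (hk : 1 ≤ k) (ω : Fin n → I) {x : E} (hx : x ∈ X) :
    ‖fderiv ℝ (wordMap ψ n k ω) x‖ₑ ≤ wordNorm X φ n k ω := by
  rw [h.wordNorm_eq hX hk]
  exact le_iSup₂ (f := fun x (_ : x ∈ X) => ‖fderiv ℝ (wordMap ψ n k ω) x‖ₑ) x hx

lemma wordNorm_le (h : IsConformalExtension X φ V ψ K) (hX : UniqueDiffOn ℝ X) {n k : ℕ}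
    (hk : 1 ≤ k) (ω : Fin n → I) {x : E} (hx : x ∈ V) :
    wordNorm X φ n k ω ≤ K * ‖fderiv ℝ (wordMap ψ n k ω) x‖ₑ := by
  rw [h.wordNorm_eq hX hk]
  exact iSup₂_le fun y hy => h.distortion n k hk ω y (h.subset hy) x hx

lemma enorm_fderiv_le_mul (h : IsConformalExtension X φ V ψ K) (hX : UniqueDiffOn ℝ X)
    (hne : X.Nonempty) {n k : ℕ} (hk : 1 ≤ k) (ω : Fin n → I) {x : E} (hx : x ∈ V) :
    ‖fderiv ℝ (wordMap ψ n k ω) x‖ₑ ≤ K * wordNorm X φ n k ω := by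
  obtain ⟨y, hy⟩ := hne
  refine (h.distortion n k hk ω x hx y (h.subset hy)).trans ?_
  gcongr
  exact h.enorm_fderiv_le hX hk ω hy

lemma wordNorm_ne_top (h : IsConformalExtension X φ V ψ K) (hX : UniqueDiffOn ℝ X)
    (hne : X.Nonempty) {n k : ℕ} (hk : 1 ≤ k) (ω : Fin n → I) : wordNorm X φ n k ω ≠ ∞ := by
  obtain ⟨y, hy⟩ := hne
  exact ((h.wordNorm_le hX hk ω (h.subset hy)).trans_lt
    (ENNReal.mul_lt_top ENNReal.coe_lt_top enorm_lt_top)).ne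

variable [Nontrivial E]

lemma wordNorm_ne_zero (h : IsConformalExtension X φ V ψ K) (hX : UniqueDiffOn ℝ X)
    (hne : X.Nonempty) {n k : ℕ} (hk : 1 ≤ k) (ω : Fin n → I) : wordNorm X φ n k ω ≠ 0 := by
  obtain ⟨y, hy⟩ := hne
  refine (lt_of_lt_of_le ?_ (h.enorm_fderiv_le hX hk ω hy)).ne'
  rw [enorm_pos]
  exact norm_pos_iff.1 (h.conformalAt_word hk ω (h.subset hy)).isConformalMap_fderiv.norm_pos

lemma enorm_fderiv_append (h : IsConformalExtension X φ V ψ K) {a b k : ℕ} (hk : 1 ≤ k)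
    (ω : Fin a → I) (τ : Fin b → I) {x : E} (hx : x ∈ V) :
    ‖fderiv ℝ (wordMap ψ (a + b) k (Fin.append ω τ)) x‖ₑ =
      ‖fderiv ℝ (wordMap ψ a k ω) (wordMap ψ b (k + a) τ x)‖ₑ *
        ‖fderiv ℝ (wordMap ψ b (k + a) τ) x‖ₑ := by
  have hk' : 1 ≤ k + a := by omega
  rw [wordMap_append]
  simp only [← ofReal_norm]
  rw [ConformalAt.norm_fderiv_comp (h.conformalAt_word hk ω (h.mapsTo_word hk' τ hx))
    (h.conformalAt_word hk' τ hx), ENNReal.ofReal_mul (norm_nonneg _)]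

lemma wordNorm_append_le (h : IsConformalExtension X φ V ψ K) (hX : UniqueDiffOn ℝ X)
    {a b k : ℕ} (hk : 1 ≤ k) (ω : Fin a → I) (τ : Fin b → I) :
    wordNorm X φ (a + b) k (Fin.append ω τ) ≤
      wordNorm X φ a k ω * wordNorm X φ b (k + a) τ := by
  have hk' : 1 ≤ k + a := by omega
  rw [h.wordNorm_eq hX hk (Fin.append ω τ)]
  refine iSup₂_le fun x hx => ?_
  rw [h.enorm_fderiv_append hk ω τ (h.subset hx)]
  have hx' : wordMap ψ b (k + a) τ x ∈ X := by
    rw [h.eqOn_word hk' τ hx]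
    exact mapsTo_wordMap h.mapsTo_base hk' τ hx
  exact mul_le_mul' (h.enorm_fderiv_le hX hk ω hx') (h.enorm_fderiv_le hX hk' τ hx)

/-- By distortion the norm of the first factor is at most `K` times its derivative at the point
where the second factor lands, and there the chain rule is an equality. -/
lemma wordNorm_mul_le (h : IsConformalExtension X φ V ψ K) (hX : UniqueDiffOn ℝ X)
    {a b k : ℕ} (hk : 1 ≤ k) (ω : Fin a → I) (τ : Fin b → I) :
    wordNorm X φ a k ω * wordNorm X φ b (k + a) τ ≤
      K * wordNorm X φ (a + b) k (Fin.append ω τ) := by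
  have hk' : 1 ≤ k + a := by omega
  rw [h.wordNorm_eq hX hk' τ]
  simp only [ENNReal.mul_iSup]
  refine iSup₂_le fun x hx => ?_
  calc wordNorm X φ a k ω * ‖fderiv ℝ (wordMap ψ b (k + a) τ) x‖ₑ
      ≤ K * ‖fderiv ℝ (wordMap ψ a k ω) (wordMap ψ b (k + a) τ x)‖ₑ *
          ‖fderiv ℝ (wordMap ψ b (k + a) τ) x‖ₑ := by
        gcongr
        exact h.wordNorm_le hX hk ω (h.mapsTo_word hk' τ (h.subset hx))
    _ = K * ‖fderiv ℝ (wordMap ψ (a + b) k (Fin.append ω τ)) x‖ₑ := by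
        rw [h.enorm_fderiv_append hk ω τ (h.subset hx), mul_assoc]
    _ ≤ _ := by
        gcongr
        exact h.enorm_fderiv_le hX hk _ hx

end IsConformalExtension

/-! ### Quasi-multiplicativity of the partition sums -/

section LevelSums

variable {E I : Type*} [NormedAddCommGroup E] [InnerProductSpace ℝ E]
  {X V : Set E} {φ ψ : ℕ → I → E → E} {K : ℝ≥0}

lemma tsum_append {a b : ℕ} (f : (Fin (a + b) → I) → ℝ≥0∞) :
    ∑' ω, f ω = ∑' ω : Fin a → I, ∑' τ : Fin b → I, f (Fin.append ω τ) := by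
  rw [← (Fin.appendEquiv a b).tsum_eq f, ENNReal.tsum_prod']
  rfl

lemma levelSum_mul (X : Set E) (φ : ℕ → I → E → E) (a b k l : ℕ) (t : ℝ≥0) :
    levelSum X φ a k t * levelSum X φ b l t =
      ∑' ω : Fin a → I, ∑' τ : Fin b → I,
        (wordNorm X φ a k ω * wordNorm X φ b l τ) ^ (t : ℝ) := by
  simp only [ENNReal.mul_rpow_of_nonneg _ _ t.coe_nonneg, ENNReal.tsum_mul_left,
    ENNReal.tsum_mul_right, levelSum]

variable [Nontrivial E]

lemma IsConformalExtension.levelSum_add_le (h : IsConformalExtension X φ V ψ K)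
    (hX : UniqueDiffOn ℝ X) {a b k : ℕ} (hk : 1 ≤ k) (t : ℝ≥0) :
    levelSum X φ (a + b) k t ≤ levelSum X φ a k t * levelSum X φ b (k + a) t := by
  rw [levelSum_mul, levelSum, tsum_append]
  gcongr with ω τ
  exact h.wordNorm_append_le hX hk ω τ

lemma IsConformalExtension.levelSum_mul_le (h : IsConformalExtension X φ V ψ K)
    (hX : UniqueDiffOn ℝ X) {a b k : ℕ} (hk : 1 ≤ k) (t : ℝ≥0) :
    levelSum X φ a k t * levelSum X φ b (k + a) t ≤
      (K : ℝ≥0∞) ^ (t : ℝ) * levelSum X φ (a + b) k t := by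
  rw [levelSum_mul, levelSum, tsum_append]
  simp only [← ENNReal.tsum_mul_left, ← ENNReal.mul_rpow_of_nonneg _ _ t.coe_nonneg]
  exact ENNReal.tsum_le_tsum fun ω => ENNReal.tsum_le_tsum fun τ =>
    ENNReal.rpow_le_rpow (h.wordNorm_mul_le hX hk ω τ) t.coe_nonneg

end LevelSums

/-! ### Diameters and packing of the pieces -/

/-- Chains of balls: on a compact subset of a domain, the oscillation of a map is bounded by a
multiple of the supremum of its derivative on the domain. -/
lemma exists_oscillation_bound {E : Type*} [NormedAddCommGroup E] [NormedSpace ℝ E] {V X : Set E}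
    (hV : IsOpen V) (hVc : IsPreconnected V) (hX : IsCompact X) (hXV : X ⊆ V) :
    ∃ L : ℝ, 0 ≤ L ∧ ∀ (f : E → E) (M : ℝ), 0 ≤ M → (∀ x ∈ V, DifferentiableAt ℝ f x) →
      (∀ x ∈ V, ‖fderiv ℝ f x‖ ≤ M) → ∀ x ∈ X, ∀ y ∈ X, ‖f x - f y‖ ≤ L * M := by
  rcases X.eq_empty_or_nonempty with rfl | ⟨x₀, hx₀⟩
  · exact ⟨0, le_rfl, by simp⟩
  have hloc : ∀ x ∈ V, ∃ r : ℝ, 0 < r ∧ Metric.ball x r ⊆ V ∧ ∀ (f : E → E) (M : ℝ), 0 ≤ M →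
      (∀ x ∈ V, DifferentiableAt ℝ f x) → (∀ x ∈ V, ‖fderiv ℝ f x‖ ≤ M) →
      ∀ y ∈ Metric.ball x r, ‖f y - f x‖ ≤ r * M := by
    intro x hx
    obtain ⟨r, hr, hball⟩ := Metric.isOpen_iff.1 hV x hx
    refine ⟨r, hr, hball, fun f M hM hf hf' y hy => ?_⟩
    refine ((convex_ball x r).norm_image_sub_le_of_norm_fderiv_le (fun z hz => hf z (hball hz))
      (fun z hz => hf' z (hball hz)) (Metric.mem_ball_self hr) hy).trans ?_
    rw [mul_comm]
    gcongr
    rw [← dist_eq_norm]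
    exact (Metric.mem_ball.1 hy).le
  have hpath : ∀ y ∈ V, ∃ L : ℝ, 0 ≤ L ∧ ∀ (f : E → E) (M : ℝ), 0 ≤ M →
      (∀ x ∈ V, DifferentiableAt ℝ f x) → (∀ x ∈ V, ‖fderiv ℝ f x‖ ≤ M) →
      ‖f y - f x₀‖ ≤ L * M := by
    intro y hy
    -- The relation "the increment between `x` and `y` is at most `L * M`, with `L` independent of
    -- the map" is symmetric and transitive and holds locally, hence throughout the connected set
    -- `V`.
    refine hVc.induction₂ (fun x y => ∃ L : ℝ, 0 ≤ L ∧ ∀ (f : E → E) (M : ℝ), 0 ≤ M →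
      (∀ x ∈ V, DifferentiableAt ℝ f x) → (∀ x ∈ V, ‖fderiv ℝ f x‖ ≤ M) →
      ‖f y - f x‖ ≤ L * M) ?_ ?_ ?_ (hXV hx₀) hy
    · intro x hx
      obtain ⟨r, hr, -, h⟩ := hloc x hx
      filter_upwards [mem_nhdsWithin_of_mem_nhds (Metric.ball_mem_nhds x hr)] with y hy
      exact ⟨r, hr.le, fun f M hM hf hf' => h f M hM hf hf' y hy⟩
    · rintro x y z - - - ⟨L, hL, h⟩ ⟨L', hL', h'⟩
      refine ⟨L + L', by positivity, fun f M hM hf hf' => ?_⟩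
      have h1 := h f M hM hf hf'
      have h2 := h' f M hM hf hf'
      have h3 := norm_sub_le_norm_sub_add_norm_sub (f z) (f y) (f x)
      linarith [add_mul L L' M]
    · rintro x y - - ⟨L, hL, h⟩
      exact ⟨L, hL, fun f M hM hf hf' => by rw [norm_sub_rev]; exact h f M hM hf hf'⟩
  have hunif : ∃ L : ℝ, 0 ≤ L ∧ ∀ y ∈ X, ∀ (f : E → E) (M : ℝ), 0 ≤ M →
      (∀ x ∈ V, DifferentiableAt ℝ f x) → (∀ x ∈ V, ‖fderiv ℝ f x‖ ≤ M) →
      ‖f y - f x₀‖ ≤ L * M := by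
    refine hX.induction_on (p := fun S => ∃ L : ℝ, 0 ≤ L ∧ ∀ y ∈ S, ∀ (f : E → E) (M : ℝ), 0 ≤ M →
      (∀ x ∈ V, DifferentiableAt ℝ f x) → (∀ x ∈ V, ‖fderiv ℝ f x‖ ≤ M) →
      ‖f y - f x₀‖ ≤ L * M) ⟨0, le_rfl, by simp⟩ ?_ ?_ ?_
    · rintro S S' hS ⟨L, hL, h⟩
      exact ⟨L, hL, fun y hy => h y (hS hy)⟩
    · rintro S S' ⟨L, hL, h⟩ ⟨L', hL', h'⟩
      refine ⟨max L L', le_max_of_le_left hL, fun y hy f M hM hf hf' => ?_⟩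
      rcases hy with hy | hy
      · exact (h y hy f M hM hf hf').trans (by gcongr; exact le_max_left _ _)
      · exact (h' y hy f M hM hf hf').trans (by gcongr; exact le_max_right _ _)
    · intro x hx
      obtain ⟨r, hr, -, h⟩ := hloc x (hXV hx)
      obtain ⟨L, hL, h'⟩ := hpath x (hXV hx)
      refine ⟨Metric.ball x r, mem_nhdsWithin_of_mem_nhds (Metric.ball_mem_nhds x hr), r + L,
        by positivity, fun y hy f M hM hf hf' => ?_⟩
      have h1 := h f M hM hf hf' y hy
      have h2 := h' f M hM hf hf'
      have h3 := norm_sub_le_norm_sub_add_norm_sub (f y) (f x) (f x₀)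
      linarith [add_mul r L M]
  obtain ⟨L, hL, h⟩ := hunif
  refine ⟨L + L, by positivity, fun f M hM hf hf' x hx y hy => ?_⟩
  have h1 := h x hx f M hM hf hf'
  have h2 := h y hy f M hM hf hf'
  have h3 := norm_sub_le_norm_sub_add_norm_sub (f x) (f x₀) (f y)
  rw [norm_sub_rev (f x₀)] at h3
  linarith [add_mul L L M]

namespace IsConformalExtension

variable {E I : Type*} [NormedAddCommGroup E] [InnerProductSpace ℝ E]
  {X V : Set E} {φ ψ : ℕ → I → E → E} {K : ℝ≥0}

/-- `X` need not be convex, so the mean value inequality is applied along chains of balls in `V`,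
where the derivative is at most `K` times the word norm. A single `L` serves all words. -/
lemma exists_ediam_image_le (h : IsConformalExtension X φ V ψ K) (hX : UniqueDiffOn ℝ X)
    (hc : IsCompact X) (hne : X.Nonempty) :
    ∃ L : ℝ≥0, ∀ n k, 1 ≤ k → ∀ ω : Fin n → I,
      Metric.ediam (wordMap φ n k ω '' X) ≤ L * wordNorm X φ n k ω := by
  obtain ⟨L, hL, hosc⟩ :=
    exists_oscillation_bound h.isOpen h.isConnected.isPreconnected hc h.subset
  refine ⟨L.toNNReal * K, fun n k hk ω => ?_⟩
  have hfin := h.wordNorm_ne_top hX hne hk ω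
  rw [← (h.eqOn_word hk ω).image_eq]
  refine Metric.ediam_le ?_
  rintro _ ⟨x, hx, rfl⟩ _ ⟨y, hy, rfl⟩
  have hM : ENNReal.ofReal (K * (wordNorm X φ n k ω).toReal) = K * wordNorm X φ n k ω := by
    rw [ENNReal.ofReal_mul K.coe_nonneg, ENNReal.ofReal_coe_nnreal, ENNReal.ofReal_toReal hfin]
  have := hosc (wordMap ψ n k ω) (K * (wordNorm X φ n k ω).toReal) (by positivity)
    (fun z hz => (h.conformalAt_word hk ω hz).differentiableAt) (fun z hz => ?_) x hx y hy
  · rw [edist_dist, dist_eq_norm, ENNReal.coe_mul, mul_assoc, ← hM]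
    change _ ≤ ENNReal.ofReal L * _
    rw [← ENNReal.ofReal_mul hL]
    exact ENNReal.ofReal_le_ofReal this
  · rw [← ENNReal.ofReal_le_ofReal_iff (by positivity), hM, ofReal_norm]
    exact h.enorm_fderiv_le_mul hX hne hk ω hz

variable [FiniteDimensional ℝ E]

/-- The derivative is injective, hence bijective in finite dimension, so the extension maps
neighbourhoods of `x` onto neighbourhoods of its image. -/
lemma mapsTo_interior (h : IsConformalExtension X φ V ψ K) {j : ℕ} (hj : 1 ≤ j) (i : I) :
    MapsTo (φ j i) (interior X) (interior X) := by
  intro x hx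
  have hxV : x ∈ V := h.subset (interior_subset hx)
  have hstrict : HasStrictFDerivAt (ψ j i) (fderiv ℝ (ψ j i) x) x :=
    ((h.contDiffOn j hj i).contDiffAt (h.isOpen.mem_nhds hxV)).hasStrictFDerivAt one_ne_zero
  have hsurj : (fderiv ℝ (ψ j i) x : E →ₗ[ℝ] E).range = ⊤ := by
    rw [LinearMap.range_eq_top]
    refine LinearMap.injective_iff_surjective.1 ?_
    exact (h.conformalAt j hj i x hxV).isConformalMap_fderiv.injective
  have hmap := hstrict.map_nhds_eq_of_surj hsurj
  rw [mem_interior_iff_mem_nhds, ← h.eqOn j hj i (interior_subset hx), ← hmap, mem_map]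
  filter_upwards [mem_interior_iff_mem_nhds.1 hx] with y hy
  rw [mem_preimage, h.eqOn j hj i hy]
  exact h.mapsTo_base j hj i hy

/-- The open set condition separates two words at their first differing letter; the common prefix
before it acts injectively. -/
lemma disjoint_word_images (h : IsConformalExtension X φ V ψ K)
    (hd : ∀ j, 1 ≤ j → ∀ a b, a ≠ b → Disjoint (φ j a '' interior X) (φ j b '' interior X))
    {n k : ℕ} (hk : 1 ≤ k) {ω τ : Fin n → I} (hωτ : ω ≠ τ) :
    Disjoint (wordMap φ n k ω '' interior X) (wordMap φ n k τ '' interior X) := by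
  induction n generalizing k with
  | zero => exact absurd (Subsingleton.elim ω τ) hωτ
  | succ n ih =>
    have hint : ∀ σ : Fin n → I, MapsTo (wordMap φ n (k + 1) σ) (interior X) (interior X) :=
      fun σ => mapsTo_wordMap (fun j hj i => h.mapsTo_interior hj i) (by omega) σ
    simp only [wordMap, image_comp]
    by_cases h0 : ω 0 = τ 0
    · have htail : Fin.tail ω ≠ Fin.tail τ := by
        intro ht
        apply hωτ
        rw [← Fin.cons_self_tail ω, ← Fin.cons_self_tail τ, h0, ht]
      rw [h0]
      have hinj : InjOn (φ k (τ 0)) X :=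
        ((h.injOn k hk (τ 0)).mono h.subset).congr (h.eqOn k hk (τ 0))
      rw [Set.disjoint_left]
      rintro _ ⟨a, ha, rfl⟩ ⟨b, hb, hab⟩
      have haX : a ∈ X := by
        obtain ⟨a', ha', rfl⟩ := ha
        exact interior_subset (hint _ ha')
      have hbX : b ∈ X := by
        obtain ⟨b', hb', rfl⟩ := hb
        exact interior_subset (hint _ hb')
      obtain rfl := hinj hbX haX hab
      exact (ih (by omega) htail).le_bot ⟨ha, hb⟩
    · exact (hd k hk _ _ h0).mono (image_mono (hint _).image_subset)
        (image_mono (hint _).image_subset)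

variable [Nontrivial E]

/-- The words `τ` of a given length with `‖Dφ_τ‖ > r` whose pieces `φ_τ(X)` meet a given ball of
radius `r` are bounded in number. -/
lemma exists_card_le (h : IsConformalExtension X φ V ψ K)
    (hd : ∀ j, 1 ≤ j → ∀ a b, a ≠ b → Disjoint (φ j a '' interior X) (φ j b '' interior X))
    (hc : IsCompact X) (hne : X.Nonempty) (hcone : HasFatCones X) :
    ∃ C : ℝ, ∀ n k, 1 ≤ k → ∀ (x : E) (r : ℝ), 0 < r → ∀ T : Finset (Fin n → I),
      (∀ τ ∈ T, ENNReal.ofReal r < wordNorm X φ n k τ ∧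
        (wordMap φ n k τ '' X ∩ Metric.ball x r).Nonempty) → (T.card : ℝ) ≤ C := by
  have hX := hcone.uniqueDiffOn
  let _ : MeasurableSpace E := borel E
  have : BorelSpace E := ⟨rfl⟩
  obtain ⟨ρ, hρ, hcone⟩ := hcone
  obtain ⟨R, hR⟩ := Metric.isBounded_iff.1 hc.isBounded
  have hR0 : 0 ≤ R := by
    obtain ⟨z, hz⟩ := hne
    simpa using hR hz hz
  have hK : (0 : ℝ) < K := lt_of_lt_of_le one_pos h.one_le
  set q := Module.finrank ℝ E with hq
  set μ : Measure E := volume with hμ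
  -- A volume ratio: the pieces contain disjoint sets of volume at least that of a ball of radius `r
  -- * ρ / K`, all inside one ball of radius `r * (R + ρ + 1)`.
  refine ⟨(K * (R + ρ + 1) / ρ) ^ q, fun n k hk x r hr T hT => ?_⟩
  set β := (μ (Metric.ball 0 1)).toReal with hβ
  have hβpos : 0 < β := ENNReal.toReal_pos (Metric.measure_ball_pos μ 0 one_pos).ne'
    measure_ball_lt_top.ne
  have hvol : ∀ (y : E) (s : ℝ), 0 ≤ s → μ (Metric.ball y s) = ENNReal.ofReal (s ^ q * β) := by
    intro y s hs
    rw [Measure.addHaar_ball μ y hs, ENNReal.ofReal_mul (by positivity), hβ,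
      ENNReal.ofReal_toReal measure_ball_lt_top.ne]
  have key : ∀ τ ∈ T, ∃ B : Set E, MeasurableSet B ∧ B ⊆ interior X ∧
      wordMap φ n k τ '' B ⊆ Metric.ball x (r * (R + ρ + 1)) ∧
      ENNReal.ofReal ((r * ρ / K) ^ q * β) ≤ μ (wordMap φ n k τ '' B) := by
    intro τ hτ
    obtain ⟨hN, y, ⟨z, hz, hzy⟩, hyb⟩ := hT τ hτ
    have hfin := h.wordNorm_ne_top hX hne hk τ
    set N := (wordNorm X φ n k τ).toReal with hNdef
    have hNe : wordNorm X φ n k τ = ENNReal.ofReal N := (ENNReal.ofReal_toReal hfin).symm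
    have hrN : r < N := (ENNReal.ofReal_lt_iff_lt_toReal hr.le hfin).1 hN
    have hNpos : 0 < N := hr.trans hrN
    obtain ⟨u, hu⟩ := hcone z hz
    have hs : 0 < r / N := by positivity
    have hs1 : r / N ≤ 1 := by rw [div_le_one hNpos]; exact hrN.le
    -- The cone at `z` is shrunk so that its image has size comparable to `r`; the assumption `r <
    -- N` gives `s ≤ 1`.
    set s := r / N with hsdef
    have hsN : s * N = r := by rw [hsdef]; field_simp
    have hD := convexHull_fatCone_subset hρ hz hu
    have hu1 : ‖u‖ ≤ R := by
      have : z + u ∈ X := hD (subset_convexHull ℝ _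
        (mem_insert_of_mem _ (Metric.mem_ball_self hρ)))
      simpa [dist_eq_norm] using hR this hz
    have hder : ∀ w ∈ X, ‖fderiv ℝ (wordMap ψ n k τ) w‖ ≤ N := by
      intro w hw
      have := h.enorm_fderiv_le hX hk τ hw
      rwa [← ofReal_norm, hNe, ENNReal.ofReal_le_ofReal_iff hNpos.le] at this
    have hder' : ∀ w ∈ V, N / K ≤ ‖fderiv ℝ (wordMap ψ n k τ) w‖ := by
      intro w hw
      have := h.wordNorm_le hX hk τ hw
      rw [← ofReal_norm, hNe, ← ENNReal.ofReal_coe_nnreal, ← ENNReal.ofReal_mul K.coe_nonneg,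
        ENNReal.ofReal_le_ofReal_iff (by positivity)] at this
      rwa [div_le_iff₀' hK]
    have hBX := hu s hs hs1
    have hBV : Metric.ball (z + s • u) (s * ρ) ⊆ V :=
      hBX.trans (interior_subset.trans h.subset)
    have heq : wordMap φ n k τ '' Metric.ball (z + s • u) (s * ρ) =
        wordMap ψ n k τ '' Metric.ball (z + s • u) (s * ρ) :=
      (((h.eqOn_word hk τ).mono (hBX.trans interior_subset)).image_eq).symm
    refine ⟨Metric.ball (z + s • u) (s * ρ), Metric.isOpen_ball.measurableSet, hBX, ?_, ?_⟩
    · rw [heq]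
      rintro _ ⟨w, hw, rfl⟩
      -- The cone itself is convex and lies in `X`, so here the mean value inequality applies with
      -- constant `N`.
      have h1 := (convex_convexHull ℝ (insert z
        (Metric.ball (z + u) ρ))).norm_image_sub_le_of_norm_fderiv_le (f := wordMap ψ n k τ) (C := N) (𝕜 := ℝ)
        (fun v hv => (h.conformalAt_word hk τ (h.subset (hD hv))).differentiableAt)
        (fun v hv => hder v (hD hv)) (subset_convexHull ℝ _ (mem_insert _ _))
        (ball_subset_convexHull_fatCone hs hs1 hw)
      have h2 : ‖w - z‖ ≤ s * (R + ρ) := by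
        rw [Metric.mem_ball, dist_eq_norm] at hw
        calc ‖w - z‖ = ‖(w - (z + s • u)) + s • u‖ := by congr 1; abel
          _ ≤ ‖w - (z + s • u)‖ + ‖s • u‖ := norm_add_le _ _
          _ ≤ s * ρ + s * R := by
              rw [norm_smul, Real.norm_of_nonneg hs.le]
              gcongr
          _ = _ := by ring
      rw [h.eqOn_word hk τ hz, hzy] at h1
      rw [Metric.mem_ball] at hyb ⊢
      calc dist (wordMap ψ n k τ w) x ≤ dist (wordMap ψ n k τ w) y + dist y x :=
            dist_triangle _ _ _
        _ < N * (s * (R + ρ)) + r := by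
            refine add_lt_add_of_le_of_lt ?_ hyb
            rw [dist_eq_norm]
            exact h1.trans (by gcongr)
        _ = (s * N) * (R + ρ) + r := by ring
        _ = r * (R + ρ + 1) := by rw [hsN]; ring
    · rw [heq, ← lintegral_abs_det_fderiv_eq_addHaar_image μ Metric.isOpen_ball.measurableSet
        (f' := fderiv ℝ (wordMap ψ n k τ))
        (fun w hw => (h.conformalAt_word hk τ
          (hBV hw)).differentiableAt.hasFDerivAt.hasFDerivWithinAt)
        ((h.injOn_word hk τ).mono hBV)]
      calc ENNReal.ofReal ((r * ρ / K) ^ q * β)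
          = ∫⁻ _ in Metric.ball (z + s • u) (s * ρ), ENNReal.ofReal ((N / K) ^ q) ∂μ := by
            rw [setLIntegral_const, hvol _ _ (by positivity), ← ENNReal.ofReal_mul (by positivity),
              ← mul_assoc, ← mul_pow, ← hsN]
            congr 3
            ring
        _ ≤ _ := by
            refine setLIntegral_mono' Metric.isOpen_ball.measurableSet fun w hw => ?_
            rw [(h.conformalAt_word hk τ (hBV hw)).isConformalMap_fderiv.abs_det]
            refine ENNReal.ofReal_le_ofReal ?_
            gcongr
            exact hder' w (hBV hw)
  choose! B hBm hBX hBball hBvol using key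
  have hmeas : ∀ τ ∈ T, MeasurableSet (wordMap φ n k τ '' B τ) := by
    intro τ hτ
    have hBV : B τ ⊆ V := (hBX τ hτ).trans (interior_subset.trans h.subset)
    rw [← ((h.eqOn_word hk τ).mono ((hBX τ hτ).trans interior_subset)).image_eq]
    exact measurable_image_of_fderivWithin (hBm τ hτ)
      (fun w hw => (h.conformalAt_word hk τ
          (hBV hw)).differentiableAt.hasFDerivAt.hasFDerivWithinAt)
      ((h.injOn_word hk τ).mono hBV)
  have hdisj : (T : Set (Fin n → I)).PairwiseDisjoint fun τ => wordMap φ n k τ '' B τ :=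
    fun τ hτ σ hσ hne' => (h.disjoint_word_images hd hk hne').mono (image_mono (hBX τ hτ))
      (image_mono (hBX σ hσ))
  have hsum : ∑ τ ∈ T, μ (wordMap φ n k τ '' B τ) ≤ μ (Metric.ball x (r * (R + ρ + 1))) := by
    rw [← measure_biUnion_finset hdisj hmeas]
    exact measure_mono (iUnion₂_subset hBball)
  have hcount : (T.card : ℝ≥0∞) * ENNReal.ofReal ((r * ρ / K) ^ q * β) ≤
      ENNReal.ofReal ((r * (R + ρ + 1)) ^ q * β) := by
    rw [← hvol x (r * (R + ρ + 1)) (by positivity)]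
    refine le_trans ?_ hsum
    rw [← nsmul_eq_mul]
    exact Finset.card_nsmul_le_sum _ _ _ hBvol
  rw [← ENNReal.ofReal_natCast, ← ENNReal.ofReal_mul (by positivity),
    ENNReal.ofReal_le_ofReal_iff (by positivity), ← mul_assoc,
    mul_le_mul_iff_left₀ hβpos, ← le_div_iff₀ (by positivity), ← div_pow] at hcount
  refine hcount.trans_eq ?_
  congr 1
  field_simp

end IsConformalExtension

/-! ### Pressure as an exponential growth rate -/

section Pressure

variable {E I : Type*} [NormedAddCommGroup E] [NormedSpace ℝ E] {X : Set E} {φ : ℕ → I → E → E}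

lemma lowerPressure_eq_expGrowthInf (X : Set E) (φ : ℕ → I → E → E) (t : ℝ≥0) :
    lowerPressure X φ t = ExpGrowth.expGrowthInf fun n => levelSum X φ n 1 t := by
  unfold lowerPressure ExpGrowth.expGrowthInf
  congr 1
  funext n
  rw [one_div, EReal.coe_inv, mul_comm]
  rfl

/-- The uniform contraction condition in terms of the norms of words. -/
def IsContracting (X : Set E) (φ : ℕ → I → E → E) (η : ℝ) (M : ℕ) : Prop :=
  0 < η ∧ η < 1 ∧ ∀ m, M ≤ m → ∀ k, 1 ≤ k → ∀ ω : Fin (m + 1) → I,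
    wordNorm X φ (m + 1) k ω ≤ ENNReal.ofReal (η ^ m)

lemma IsContracting.wordNorm_le_one {η : ℝ} {M : ℕ} (h : IsContracting X φ η M) {n k : ℕ}
    (hn : M + 1 ≤ n) (hk : 1 ≤ k) (ω : Fin n → I) : wordNorm X φ n k ω ≤ 1 := by
  obtain ⟨m, rfl⟩ : ∃ m, n = m + 1 := ⟨n - 1, by omega⟩
  refine (h.2.2 m (by omega) k hk ω).trans ?_
  rw [← ENNReal.ofReal_one]
  exact ENNReal.ofReal_le_ofReal (pow_le_one₀ h.1.le h.2.1.le)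

lemma IsContracting.eventually_wordNorm_le {η : ℝ} {M : ℕ} (h : IsContracting X φ η M) {ε : ℝ≥0∞}
    (hε : 0 < ε) :
    ∀ᶠ n : ℕ in atTop, ∀ k, 1 ≤ k → ∀ ω : Fin n → I, wordNorm X φ n k ω ≤ ε := by
  have hlim : Tendsto (fun m : ℕ => ENNReal.ofReal (η ^ m)) atTop (𝓝 0) := by
    rw [← ENNReal.ofReal_zero]
    exact ENNReal.tendsto_ofReal (tendsto_pow_atTop_nhds_zero_of_lt_one h.1.le h.2.1)
  obtain ⟨N, hN⟩ := eventually_atTop.1 (hlim.eventually_le_const hε)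
  filter_upwards [eventually_ge_atTop (max M N + 1)] with n hn k hk ω
  obtain ⟨m, rfl⟩ : ∃ m, n = m + 1 := ⟨n - 1, by omega⟩
  have h1 := le_max_left M N
  have h2 := le_max_right M N
  exact (h.2.2 m (by omega) k hk ω).trans (hN m (by omega))

lemma IsContracting.levelSum_anti {η : ℝ} {M : ℕ} (h : IsContracting X φ η M) {s t : ℝ≥0}
    (hst : t ≤ s) {n k : ℕ} (hn : M + 1 ≤ n) (hk : 1 ≤ k) :
    levelSum X φ n k s ≤ levelSum X φ n k t :=
  ENNReal.tsum_le_tsum fun ω =>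
    ENNReal.rpow_le_rpow_of_exponent_ge (h.wordNorm_le_one hn hk ω) (by exact_mod_cast hst)

lemma IsContracting.antitone_lowerPressure {η : ℝ} {M : ℕ} (h : IsContracting X φ η M) :
    Antitone (lowerPressure X φ) := by
  intro t s hst
  rw [lowerPressure_eq_expGrowthInf, lowerPressure_eq_expGrowthInf]
  refine ExpGrowth.expGrowthInf_eventually_monotone ?_
  filter_upwards [eventually_ge_atTop (M + 1)] with n hn
  exact h.levelSum_anti hst hn le_rfl

lemma IsContracting.levelSum_le {η : ℝ} {M : ℕ} (h : IsContracting X φ η M) {s t : ℝ≥0}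
    (hst : t ≤ s) {m k : ℕ} (hm : M ≤ m) (hk : 1 ≤ k) :
    levelSum X φ (m + 1) k s ≤
      ENNReal.ofReal (η ^ m) ^ ((s : ℝ) - t) * levelSum X φ (m + 1) k t := by
  have hst' : (0 : ℝ) ≤ (s : ℝ) - t := sub_nonneg.2 (by exact_mod_cast hst)
  rw [levelSum, levelSum, ← ENNReal.tsum_mul_left]
  refine ENNReal.tsum_le_tsum fun ω => ?_
  calc wordNorm X φ (m + 1) k ω ^ (s : ℝ)
      = wordNorm X φ (m + 1) k ω ^ ((s : ℝ) - t + t) := by rw [sub_add_cancel]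
    _ = wordNorm X φ (m + 1) k ω ^ ((s : ℝ) - t) * wordNorm X φ (m + 1) k ω ^ (t : ℝ) :=
        ENNReal.rpow_add_of_nonneg _ _ hst' t.coe_nonneg
    _ ≤ _ := by
        gcongr
        exact h.2.2 m hm k hk ω

/-- Raising the exponent from `t` to `s` gains a factor `e^{-c}` per letter, with `c = -(s - t) log
η`. Since `P(t) ≤ 0 < c`, the sum at `t` is at most `e^{cn}` for infinitely many `n`. -/
lemma IsContracting.frequently_levelSum_le {η : ℝ} {M : ℕ} (h : IsContracting X φ η M) {s t : ℝ≥0}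
    (hst : t < s) (hP : lowerPressure X φ t ≤ 0) :
    ∃ C : ℝ≥0, ∃ᶠ n : ℕ in atTop, levelSum X φ n 1 s ≤ C := by
  have hst' : (0 : ℝ) < (s : ℝ) - t := sub_pos.2 (by exact_mod_cast hst)
  set a := -Real.log η with ha
  have hapos : 0 < a := neg_pos.2 (Real.log_neg h.1 h.2.1)
  have hη : η = Real.exp (-a) := by rw [ha, neg_neg, Real.exp_log h.1]
  set c := a * ((s : ℝ) - t) with hc
  have hcpos : 0 < c := by positivity
  have hfreq := ExpGrowth.frequently_le_exp (u := fun n => levelSum X φ n 1 t) (a := (c : EReal))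
    (by rw [← lowerPressure_eq_expGrowthInf]; exact hP.trans_lt (by exact_mod_cast hcpos))
  -- The contraction bound for `n` letters is `η ^ (n - 1)`, so one factor `e^c` is left over.
  refine ⟨(Real.exp c).toNNReal, ?_⟩
  refine (hfreq.and_eventually (eventually_ge_atTop (M + 1))).mono ?_
  rintro n ⟨hn, hMn⟩
  obtain ⟨m, rfl⟩ : ∃ m, n = m + 1 := ⟨n - 1, by omega⟩
  refine (h.levelSum_le hst.le (by omega) le_rfl).trans ?_
  have hexp : EReal.exp ((c : EReal) * ((m + 1 : ℕ) : EReal)) =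
      ENNReal.ofReal (Real.exp (c * (m + 1 : ℕ))) := by
    rw [← EReal.exp_coe]
    norm_cast
  calc ENNReal.ofReal (η ^ m) ^ ((s : ℝ) - t) * levelSum X φ (m + 1) 1 t
      ≤ ENNReal.ofReal (η ^ m) ^ ((s : ℝ) - t) * ENNReal.ofReal (Real.exp (c * (m + 1 : ℕ))) := by
        gcongr
        exact hn.trans_eq hexp
    _ = ENNReal.ofReal (Real.exp c) := by
        rw [ENNReal.ofReal_rpow_of_nonneg (by have := h.1; positivity) hst'.le,
          ← ENNReal.ofReal_mul (by have := h.1; positivity), hη, ← Real.exp_nat_mul,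
          ← Real.exp_mul, ← Real.exp_add]
        congr 2
        rw [hc]
        push_cast
        ring

end Pressure

lemma IsNCIFS.exists_isContracting {d : ℕ} {I : Type*} {X : Set (EuclideanSpace ℝ (Fin d))}
    {φ : ℕ → I → EuclideanSpace ℝ (Fin d) → EuclideanSpace ℝ (Fin d)} (h : IsNCIFS X φ) :
    ∃ η M, IsContracting X φ η M := by
  obtain ⟨η, h0, h1, M, hM⟩ := h.contraction
  refine ⟨η, M, h0, h1, fun m hm k hk ω => iSup₂_le fun x hx => ?_⟩
  rw [← ofReal_norm]
  exact ENNReal.ofReal_le_ofReal (hM m hm k hk ω x hx)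

/-! ### Upper bound for the dimension -/

section UpperBound

variable {E I : Type*} [NormedAddCommGroup E] [InnerProductSpace ℝ E]
  {X V : Set E} {φ ψ : ℕ → I → E → E} {K : ℝ≥0}

lemma IsConformalExtension.dimH_limitSet_le [Countable I] (h : IsConformalExtension X φ V ψ K)
    (hX : UniqueDiffOn ℝ X) (hc : IsCompact X) (hne : X.Nonempty) {η : ℝ} {M : ℕ}
    (hη : IsContracting X φ η M) {t : ℝ≥0} (hP : lowerPressure X φ t ≤ 0) :
    dimH (limitSet X φ) ≤ t := by
  let _ : MeasurableSpace E := borel E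
  have : BorelSpace E := ⟨rfl⟩
  obtain ⟨L, hL⟩ := h.exists_ediam_image_le hX hc hne
  have key : ∀ s : ℝ≥0, t < s → dimH (limitSet X φ) ≤ s := by
    intro s hst
    refine dimH_le_of_hausdorffMeasure_ne_top ?_
    obtain ⟨C, hC⟩ := hη.frequently_levelSum_le hst hP
    have hlim : Tendsto (fun m : ℕ => (L : ℝ≥0∞) * ENNReal.ofReal (η ^ (m - 1))) atTop (𝓝 0) := by
      rw [← mul_zero (L : ℝ≥0∞), ← ENNReal.ofReal_zero]
      refine ENNReal.Tendsto.const_mul (ENNReal.tendsto_ofReal ?_) (Or.inr ENNReal.coe_ne_top)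
      exact (tendsto_pow_atTop_nhds_zero_of_lt_one hη.1.le hη.2.1).comp (tendsto_sub_atTop_nat 1)
    have hle := Measure.hausdorffMeasure_le_liminf_tsum (s : ℝ) (limitSet X φ) _ hlim
      (fun n (ω : Fin n → I) => wordMap φ n 1 ω '' X) (by
        filter_upwards [eventually_ge_atTop (M + 1)] with n hn ω
        refine (hL n 1 le_rfl ω).trans ?_
        obtain ⟨m, rfl⟩ : ∃ m, n = m + 1 := ⟨n - 1, by omega⟩
        gcongr
        exact hη.2.2 m (by omega) 1 le_rfl ω) (by
        filter_upwards [eventually_ge_atTop 1] with n hn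
        exact iInter₂_subset n hn)
    refine (hle.trans_lt (lt_of_le_of_lt (b := (L : ℝ≥0∞) ^ (s : ℝ) * C) ?_ ?_)).ne
    -- Covers along infinitely many lengths suffice for Hausdorff measure, which is why the lower
    -- pressure is the right quantity.
    · refine liminf_le_of_frequently_le' (hC.mono fun n hn => ?_)
      calc ∑' ω : Fin n → I, Metric.ediam (wordMap φ n 1 ω '' X) ^ (s : ℝ)
          ≤ ∑' ω : Fin n → I, (L : ℝ≥0∞) ^ (s : ℝ) * wordNorm X φ n 1 ω ^ (s : ℝ) := by
            refine ENNReal.tsum_le_tsum fun ω => ?_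
            rw [← ENNReal.mul_rpow_of_nonneg _ _ s.coe_nonneg]
            exact ENNReal.rpow_le_rpow (hL n 1 le_rfl ω) s.coe_nonneg
        _ = (L : ℝ≥0∞) ^ (s : ℝ) * levelSum X φ n 1 s := by rw [ENNReal.tsum_mul_left]; rfl
        _ ≤ _ := by gcongr
    · exact ENNReal.mul_lt_top (ENNReal.rpow_lt_top_of_nonneg s.coe_nonneg ENNReal.coe_ne_top)
        ENNReal.coe_lt_top
  refine le_of_forall_gt_imp_ge_of_dense fun b hb => ?_
  obtain ⟨s, hs, hsb⟩ := ENNReal.lt_iff_exists_nnreal_btwn.1 hb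
  exact (key s (by exact_mod_cast hs)).trans hsb.le

end UpperBound

/-! ### Hausdorff dimension from finite ball covers -/

section CoveringCriterion

/-- A compact set all of whose finite coverings by small balls satisfy `1 ≤ C ∑ r_j ^ t` has
Hausdorff dimension at least `t`. -/
lemma le_dimH_of_forall_finite_ball_cover {E : Type*} [MetricSpace E] [Nonempty E] {J : Set E}
    (hJ : IsCompact J) {t : ℝ≥0} (ht : 0 < t) {C : ℝ≥0∞} (hC : C ≠ ∞)
    (h : ∀ (s : Finset ℕ) (x : ℕ → E) (r : ℕ → ℝ), (∀ j, 0 < r j) → (∀ j, r j < 1) →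
      J ⊆ ⋃ j ∈ s, Metric.ball (x j) (r j) →
      1 ≤ C * ∑ j ∈ s, ENNReal.ofReal (r j) ^ (t : ℝ)) : (t : ℝ≥0∞) ≤ dimH J := by
  let _ : MeasurableSpace E := borel E
  have : BorelSpace E := ⟨rfl⟩
  have htr : (0 : ℝ) < t := by exact_mod_cast ht
  refine le_dimH_of_hausdorffMeasure_ne_zero fun hzero => ?_
  set ε : ℝ≥0∞ := (C * 2 ^ (t : ℝ) * 4 + 1)⁻¹ with hε
  have h2t : (2 : ℝ≥0∞) ^ (t : ℝ) ≠ ∞ := ENNReal.rpow_ne_top_of_nonneg t.coe_nonneg (by simp)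
  have hA : C * 2 ^ (t : ℝ) * 4 + 1 ≠ ∞ := by
    refine ENNReal.add_ne_top.2 ⟨ENNReal.mul_ne_top (ENNReal.mul_ne_top hC h2t) (by simp), by simp⟩
  have hεpos : 0 < ε := ENNReal.inv_pos.2 hA
  rw [Measure.hausdorffMeasure_apply] at hzero
  -- Diameters at most `1/8`, enlarged by at most `1/8`, keep all radii below 1.
  have h8 : (0 : ℝ≥0∞) < ENNReal.ofReal (1 / 8) := by simp
  have hinf := le_antisymm ((le_iSup₂ (f := fun (r : ℝ≥0∞) (_ : 0 < r) =>
    ⨅ (u : ℕ → Set E) (_ : J ⊆ ⋃ n, u n) (_ : ∀ n, Metric.ediam (u n) ≤ r),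
      ∑' n, ⨆ _ : (u n).Nonempty, Metric.ediam (u n) ^ (t : ℝ)) _ h8).trans hzero.le) bot_le
  have hlt := hinf.trans_lt hεpos
  simp only [iInf_lt_iff] at hlt
  obtain ⟨u, hcov, hdiam, hsum⟩ := hlt
  obtain ⟨e, hepos, hesum⟩ := ENNReal.exists_pos_sum_of_countable hεpos.ne' ℕ
  -- centres and radii
  have hx : ∀ j, ∃ x, (u j).Nonempty → x ∈ u j := by
    intro j
    by_cases hj : (u j).Nonempty
    · exact ⟨hj.some, fun _ => hj.some_mem⟩
    · exact ⟨Classical.arbitrary E, fun hj' => absurd hj' hj⟩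
  choose x hx using hx
  set a : ℕ → ℝ≥0∞ := fun j => ⨆ _ : (u j).Nonempty, Metric.ediam (u j) with ha
  have ha8 : ∀ j, a j ≤ ENNReal.ofReal (1 / 8) := fun j => iSup_le fun _ => hdiam j
  have hafin : ∀ j, a j ≠ ∞ := fun j => ((ha8 j).trans_lt ENNReal.ofReal_lt_top).ne
  have hasum : ∑' j, a j ^ (t : ℝ) < ε := by
    refine lt_of_le_of_lt (ENNReal.tsum_le_tsum fun j => ?_) hsum
    by_cases hj : (u j).Nonempty
    · simp [ha, hj]
    · simp [ha, hj, htr]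
  -- The enlargement makes every radius positive and puts each covering set inside an open ball,
  -- even when its diameter is 0; its `t`-th power is at most the summable `e j`.
  set δ : ℕ → ℝ≥0 := fun j => min (1 / 8) (e j ^ (1 / (t : ℝ))) with hδ
  have hδpos : ∀ j, 0 < δ j := fun j => lt_min (by norm_num) (NNReal.rpow_pos (hepos j))
  have hδt : ∀ j, (δ j : ℝ≥0∞) ^ (t : ℝ) ≤ e j := by
    intro j
    rw [← ENNReal.coe_rpow_of_nonneg _ t.coe_nonneg, ENNReal.coe_le_coe]
    calc δ j ^ (t : ℝ) ≤ (e j ^ (1 / (t : ℝ))) ^ (t : ℝ) := by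
          gcongr
          exact min_le_right _ _
      _ = e j := by rw [← NNReal.rpow_mul, one_div_mul_cancel htr.ne', NNReal.rpow_one]
  set r : ℕ → ℝ := fun j => (a j).toReal + δ j with hr
  have hrpos : ∀ j, 0 < r j := fun j => by
    have : (0 : ℝ) < δ j := by exact_mod_cast hδpos j
    have := ENNReal.toReal_nonneg (a := a j)
    simp only [hr]
    linarith
  have hrlt : ∀ j, r j < 1 := fun j => by
    have h1 : (a j).toReal ≤ 1 / 8 := ENNReal.toReal_le_of_le_ofReal (by norm_num) (ha8 j)
    have h2 : (δ j : ℝ) ≤ 1 / 8 := by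
      have : δ j ≤ 1 / 8 := min_le_left _ _
      exact_mod_cast this
    simp only [hr]
    linarith
  have hr_eq : ∀ j, ENNReal.ofReal (r j) = a j + δ j := fun j => by
    simp only [hr]
    rw [ENNReal.ofReal_add ENNReal.toReal_nonneg (by positivity), ENNReal.ofReal_toReal (hafin j),
      ENNReal.ofReal_coe_nnreal]
  have hrt : ∀ j, ENNReal.ofReal (r j) ^ (t : ℝ) ≤ 2 ^ (t : ℝ) * (a j ^ (t : ℝ) + e j) := by
    intro j
    rw [hr_eq]
    calc (a j + δ j) ^ (t : ℝ) ≤ (2 * max (a j) (δ j)) ^ (t : ℝ) := by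
          gcongr
          rw [two_mul]
          exact add_le_add (le_max_left _ _) (le_max_right _ _)
      _ = 2 ^ (t : ℝ) * max (a j) (δ j) ^ (t : ℝ) := ENNReal.mul_rpow_of_nonneg _ _ t.coe_nonneg
      _ ≤ 2 ^ (t : ℝ) * (a j ^ (t : ℝ) + e j) := by
          gcongr
          rcases max_choice (a j) (δ j : ℝ≥0∞) with hm | hm <;> rw [hm]
          · exact le_self_add
          · exact (hδt j).trans le_add_self
  have hcov' : J ⊆ ⋃ j, Metric.ball (x j) (r j) := by
    intro y hy
    obtain ⟨j, hj⟩ := mem_iUnion.1 (hcov hy)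
    refine mem_iUnion.2 ⟨j, ?_⟩
    have hne : (u j).Nonempty := ⟨y, hj⟩
    rw [Metric.mem_ball, ← ENNReal.ofReal_lt_ofReal_iff (hrpos j), ← edist_dist, hr_eq]
    have haj : a j = Metric.ediam (u j) := by simp [ha, hne]
    refine lt_of_le_of_lt (b := a j) ?_ ?_
    · rw [haj]
      exact Metric.edist_le_ediam_of_mem hj (hx j hne)
    · exact ENNReal.lt_add_right (hafin j) (by exact_mod_cast (hδpos j).ne')
  obtain ⟨s, hs⟩ := hJ.elim_finite_subcover _ (fun j => Metric.isOpen_ball) hcov'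
  have hone := h s x r hrpos hrlt hs
  have hbound : ∑ j ∈ s, ENNReal.ofReal (r j) ^ (t : ℝ) ≤ 2 ^ (t : ℝ) * (ε + ε) := by
    calc ∑ j ∈ s, ENNReal.ofReal (r j) ^ (t : ℝ)
        ≤ ∑ j ∈ s, 2 ^ (t : ℝ) * (a j ^ (t : ℝ) + e j) := Finset.sum_le_sum fun j _ => hrt j
      _ ≤ ∑' j, 2 ^ (t : ℝ) * (a j ^ (t : ℝ) + e j) := ENNReal.sum_le_tsum s
      _ = 2 ^ (t : ℝ) * (∑' j, a j ^ (t : ℝ) + ∑' j, (e j : ℝ≥0∞)) := by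
          rw [ENNReal.tsum_mul_left, ENNReal.tsum_add]
      _ ≤ _ := by gcongr
  have : (1 : ℝ≥0∞) < 1 := by
    calc (1 : ℝ≥0∞) ≤ C * (2 ^ (t : ℝ) * (ε + ε)) := hone.trans (by gcongr)
      _ ≤ (C * 2 ^ (t : ℝ) * 4) * ε := by
          rw [← two_mul, mul_assoc, mul_assoc, ← mul_assoc (2 ^ (t : ℝ)) 2 ε,
            mul_assoc (2 ^ (t : ℝ))]
          gcongr
          norm_num
      _ < (C * 2 ^ (t : ℝ) * 4 + 1) * ε := by
          rw [add_mul, one_mul]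
          refine ENNReal.lt_add_right (ENNReal.mul_ne_top (ENNReal.add_ne_top.1 hA).1 ?_) hεpos.ne'
          exact (ENNReal.inv_lt_top.2 (by simp)).ne
      _ = 1 := ENNReal.mul_inv_cancel (by simp) hA
  exact lt_irrefl _ this

end CoveringCriterion

/-! ### Prefixes of words -/

section Prefixes

variable {I E : Type*} [Nonempty I]

/-- The first `k` letters of a word. -/
noncomputable def wordPrefix {n : ℕ} (k : ℕ) (ω : Fin n → I) : Fin k → I :=
  fun i => if h : (i : ℕ) < n then ω ⟨i, h⟩ else Classical.arbitrary I

lemma wordPrefix_self {n : ℕ} (ω : Fin n → I) : wordPrefix n ω = ω := by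
  funext i
  simp [wordPrefix]

lemma wordPrefix_append {a b : ℕ} (σ : Fin a → I) (τ : Fin b → I) :
    wordPrefix a (Fin.append σ τ) = σ := by
  funext i
  have h : (i : ℕ) < a + b := by omega
  simp only [wordPrefix, h, dif_pos]
  exact Fin.append_left σ τ i

lemma init_wordPrefix {n : ℕ} (k : ℕ) (ω : Fin n → I) :
    Fin.init (wordPrefix (k + 1) ω) = wordPrefix k ω := rfl

lemma wordPrefix_eq {a b : ℕ} (ω : Fin (a + b) → I) :
    wordPrefix a ω = fun i => ω (Fin.castAdd b i) := by
  funext i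
  have h : (i : ℕ) < a + b := by omega
  simp only [wordPrefix, h, dif_pos]
  rfl

lemma append_wordPrefix {a b : ℕ} (ω : Fin (a + b) → I) :
    Fin.append (wordPrefix a ω) (fun i => ω (Fin.natAdd a i)) = ω := by
  rw [wordPrefix_eq]
  exact Fin.append_castAdd_natAdd

lemma image_wordMap_subset {φ : ℕ → I → E → E} {X : Set E}
    (h : ∀ j, 1 ≤ j → ∀ i, MapsTo (φ j i) X X) {n k l : ℕ} (hk : k ≤ n) (hl : 1 ≤ l)
    (ω : Fin n → I) :
    wordMap φ n l ω '' X ⊆ wordMap φ k l (wordPrefix k ω) '' X := by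
  obtain ⟨m, rfl⟩ := Nat.exists_eq_add_of_le hk
  conv_lhs => rw [← append_wordPrefix ω]
  rw [wordMap_append, image_comp]
  exact image_mono (mapsTo_wordMap h (by omega) _).image_subset

end Prefixes

/-! ### Lower bound for finite alphabets -/

section LevelSums

variable {E I : Type*} [NormedAddCommGroup E] [InnerProductSpace ℝ E]
  {X V : Set E} {φ ψ : ℕ → I → E → E} {K : ℝ≥0}

lemma IsConformalExtension.levelSum_ne_top [Finite I] (h : IsConformalExtension X φ V ψ K)
    (hX : UniqueDiffOn ℝ X) (hne : X.Nonempty) {n k : ℕ} (hk : 1 ≤ k) (t : ℝ≥0) :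
    levelSum X φ n k t ≠ ∞ := by
  have := Fintype.ofFinite I
  rw [levelSum, tsum_fintype]
  exact ENNReal.sum_ne_top.2 fun ω _ =>
    ENNReal.rpow_ne_top_of_nonneg t.coe_nonneg (h.wordNorm_ne_top hX hne hk ω)

variable [Nontrivial E]

lemma IsConformalExtension.levelSum_ne_zero [Nonempty I] (h : IsConformalExtension X φ V ψ K)
    (hX : UniqueDiffOn ℝ X) (hne : X.Nonempty) {n k : ℕ} (hk : 1 ≤ k) (t : ℝ≥0) :
    levelSum X φ n k t ≠ 0 := by
  intro h0
  have h1 := ENNReal.tsum_eq_zero.1 h0 (fun _ => Classical.arbitrary I)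
  exact (ENNReal.rpow_pos (pos_iff_ne_zero.2 (h.wordNorm_ne_zero hX hne hk _))
    (h.wordNorm_ne_top hX hne hk _)).ne' h1

lemma ENNReal.tsum_ne_top_of_eventually_le {f g : ℕ → ℝ≥0∞} (hf : ∀ n, f n ≠ ∞)
    (hg : ∑' n, g n ≠ ∞) (hfg : ∀ᶠ n in atTop, f n ≤ g n) : ∑' n, f n ≠ ∞ := by
  obtain ⟨N, hN⟩ := eventually_atTop.1 hfg
  rw [← (ENNReal.summable (f := fun n => f (n + N))).sum_add_tsum_nat_add']
  refine ENNReal.add_ne_top.2 ⟨ENNReal.sum_ne_top.2 fun n _ => hf n, ?_⟩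
  refine ne_top_of_le_ne_top hg ?_
  calc ∑' n, f (n + N) ≤ ∑' n, g (n + N) := ENNReal.tsum_le_tsum fun n => hN _ (by omega)
    _ ≤ ∑' n, g n := ENNReal.tsum_comp_le_tsum_of_injective (add_left_injective N) g

/-- Positive lower pressure makes the sums grow at least exponentially for all large `n`.
Convergence of the reciprocals pays for summing over all cutting lengths in `exists_ball_mass_le`.
-/
lemma tsum_inv_levelSum_ne_top [Finite I] [Nonempty I] (h : IsConformalExtension X φ V ψ K)
    (hX : UniqueDiffOn ℝ X) (hne : X.Nonempty) {t : ℝ≥0} (hP : 0 < lowerPressure X φ t) :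
    ∑' n, (levelSum X φ n 1 t)⁻¹ ≠ ∞ := by
  obtain ⟨c, hc0, hcP⟩ := EReal.lt_iff_exists_real_btwn.1 hP
  have hc : 0 < c := by exact_mod_cast hc0
  rw [lowerPressure_eq_expGrowthInf] at hcP
  refine ENNReal.tsum_ne_top_of_eventually_le (g := fun n => ENNReal.ofReal (Real.exp (-c)) ^ n)
    (fun n => ENNReal.inv_ne_top.2 (h.levelSum_ne_zero hX hne le_rfl t)) ?_ ?_
  · rw [ENNReal.tsum_geometric]
    refine ENNReal.inv_ne_top.2 (tsub_pos_of_lt ?_).ne'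
    rw [← ENNReal.ofReal_one]
    exact (ENNReal.ofReal_lt_ofReal_iff one_pos).2 (by simpa using hc)
  · filter_upwards [ExpGrowth.eventually_exp_le hcP] with n hn
    have hexp : EReal.exp ((c : EReal) * (n : EReal)) = (ENNReal.ofReal (Real.exp (-c)) ^ n)⁻¹ := by
      rw [← ENNReal.ofReal_pow (Real.exp_pos _).le, ← Real.exp_nat_mul,
        ← ENNReal.ofReal_inv_of_pos (Real.exp_pos _), ← Real.exp_neg, ← EReal.exp_coe]
      congr 1
      rw [show -((n : ℝ) * -c) = c * n by ring, EReal.coe_mul]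
      rfl
    rw [hexp] at hn
    exact ENNReal.inv_le_iff_inv_le.1 hn

/-- The empty word is the identity, so for `r < 1` no word is cut at length 0. -/
lemma IsConformalExtension.one_le_wordNorm_zero (h : IsConformalExtension X φ V ψ K)
    (hX : UniqueDiffOn ℝ X) (hne : X.Nonempty) (ω : Fin 0 → I) : 1 ≤ wordNorm X φ 0 1 ω := by
  obtain ⟨y, hy⟩ := hne
  refine le_trans ?_ (h.enorm_fderiv_le hX le_rfl ω hy)
  rw [← ofReal_norm]
  simp [wordMap]

lemma IsConformalExtension.tsum_prefix_le [Nonempty I] (h : IsConformalExtension X φ V ψ K)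
    (hX : UniqueDiffOn ℝ X) {a b : ℕ} (t : ℝ≥0) (Q : (Fin a → I) → Prop)
    [DecidablePred Q] :
    (∑' ω : Fin (a + b) → I, if Q (wordPrefix a ω) then wordNorm X φ (a + b) 1 ω ^ (t : ℝ) else 0) ≤
      (∑' σ : Fin a → I, if Q σ then wordNorm X φ a 1 σ ^ (t : ℝ) else 0) *
        levelSum X φ b (1 + a) t := by
  rw [tsum_append, levelSum, ← ENNReal.tsum_mul_right]
  refine ENNReal.tsum_le_tsum fun σ => ?_
  rw [← ENNReal.tsum_mul_left]
  refine ENNReal.tsum_le_tsum fun τ => ?_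
  rw [wordPrefix_append]
  split_ifs
  · rw [← ENNReal.mul_rpow_of_nonneg _ _ t.coe_nonneg]
    exact ENNReal.rpow_le_rpow (h.wordNorm_append_le hX le_rfl σ τ) t.coe_nonneg
  · exact zero_le

open Classical in
/-- The normalised weights `‖Dφ_ω‖ ^ t / Z_n(t)` give a ball of radius `r` mass at most a constant
times `r ^ t`. -/
lemma IsConformalExtension.exists_ball_mass_le [FiniteDimensional ℝ E] [Finite I] [Nonempty I]
    (h : IsConformalExtension X φ V ψ K)
    (hd : ∀ j, 1 ≤ j → ∀ a b, a ≠ b → Disjoint (φ j a '' interior X) (φ j b '' interior X))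
    (hc : IsCompact X) (hne : X.Nonempty) (hcone : HasFatCones X) {t : ℝ≥0}
    (hP : 0 < lowerPressure X φ t) :
    ∃ C : ℝ≥0∞, C ≠ ∞ ∧ ∀ (x : E) (r : ℝ), 0 < r → r < 1 → ∀ n,
      (∀ ω : Fin n → I, wordNorm X φ n 1 ω ≤ ENNReal.ofReal r) →
      (∑' ω : Fin n → I, if (wordMap φ n 1 ω '' X ∩ Metric.ball x r).Nonempty then
        wordNorm X φ n 1 ω ^ (t : ℝ) else 0) ≤
          C * ENNReal.ofReal r ^ (t : ℝ) * levelSum X φ n 1 t := by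
  have hX := hcone.uniqueDiffOn
  have := Fintype.ofFinite I
  obtain ⟨C₀, hC₀⟩ := h.exists_card_le hd hc hne hcone
  set A : ℝ≥0∞ := ENNReal.ofReal C₀ * Fintype.card I * (K : ℝ≥0∞) ^ (t : ℝ) with hA
  set S : ℝ≥0∞ := ∑' n, (levelSum X φ n 1 t)⁻¹ with hS
  have hKt : (K : ℝ≥0∞) ^ (t : ℝ) ≠ ∞ :=
    ENNReal.rpow_ne_top_of_nonneg t.coe_nonneg ENNReal.coe_ne_top
  -- `A` bounds the contribution of one cutting length, up to `r ^ t` and the factor `1 / Z`; `S`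
  -- sums these factors over all lengths.
  refine ⟨A * S, ENNReal.mul_ne_top (ENNReal.mul_ne_top (ENNReal.mul_ne_top
    ENNReal.ofReal_ne_top (ENNReal.natCast_ne_top _)) hKt)
      (tsum_inv_levelSum_ne_top h hX hne hP), fun x r hr hr1 n hn => ?_⟩
  -- words at which the norm drops below `r` for the first time
  set Q : (k : ℕ) → (Fin (k + 1) → I) → Prop := fun k σ =>
    wordNorm X φ (k + 1) 1 σ ≤ ENNReal.ofReal r ∧
      ENNReal.ofReal r < wordNorm X φ k 1 (Fin.init σ) ∧
      (wordMap φ k 1 (Fin.init σ) '' X ∩ Metric.ball x r).Nonempty with hQ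
  have hex : ∀ ω : Fin n → I, (wordMap φ n 1 ω '' X ∩ Metric.ball x r).Nonempty →
      ∃ k ∈ Finset.range n, Q k (wordPrefix (k + 1) ω) := by
    intro ω hω
    have hlast : ∃ k, wordNorm X φ k 1 (wordPrefix k ω) ≤ ENNReal.ofReal r :=
      ⟨n, by rw [wordPrefix_self]; exact hn ω⟩
    have hfind := Nat.find_spec hlast
    have hle : Nat.find hlast ≤ n := Nat.find_min' hlast (by rw [wordPrefix_self]; exact hn ω)
    have hne0 : Nat.find hlast ≠ 0 := by
      intro h0
      rw [h0] at hfind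
      have h1 := (h.one_le_wordNorm_zero hX hne _).trans hfind
      rw [← ENNReal.ofReal_one, ENNReal.ofReal_le_ofReal_iff hr.le] at h1
      linarith
    obtain ⟨k, hk⟩ := Nat.exists_eq_succ_of_ne_zero hne0
    rw [hk] at hfind hle
    refine ⟨k, Finset.mem_range.2 hle, hfind, ?_, ?_⟩
    · rw [init_wordPrefix]
      exact not_le.1 (Nat.find_min hlast (by omega))
    · rw [init_wordPrefix]
      exact hω.mono (inter_subset_inter_left _
        (image_wordMap_subset h.mapsTo_base (by omega) le_rfl ω))
  have hQsum : ∀ k, (∑' σ : Fin (k + 1) → I,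
      if Q k σ then wordNorm X φ (k + 1) 1 σ ^ (t : ℝ) else 0) ≤
        ENNReal.ofReal C₀ * Fintype.card I * ENNReal.ofReal r ^ (t : ℝ) := by
    intro k
    -- Packing is applied to the parents, whose norms still exceed `r`; each has at most
    -- `Fintype.card I` children.
    set T : Finset (Fin k → I) := Finset.univ.filter fun τ =>
      ENNReal.ofReal r < wordNorm X φ k 1 τ ∧
        (wordMap φ k 1 τ '' X ∩ Metric.ball x r).Nonempty with hT
    have hTcard : (T.card : ℝ) ≤ C₀ :=
      hC₀ k 1 le_rfl x r hr T fun τ hτ => (Finset.mem_filter.1 hτ).2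
    have hcard : (Finset.univ.filter (Q k)).card ≤ T.card * Fintype.card I := by
      rw [← Finset.card_univ, ← Finset.card_product]
      refine Finset.card_le_card_of_injOn (fun σ => (Fin.init σ, σ (Fin.last k))) ?_ ?_
      · intro σ hσ
        have hσ' := (Finset.mem_filter.1 hσ).2
        simp only [Finset.coe_product, Set.mem_prod, Finset.coe_univ, Set.mem_univ, and_true]
        exact Finset.mem_filter.2 ⟨Finset.mem_univ _, hσ'.2⟩
      · intro σ _ σ' _ heq
        simp only [Prod.mk.injEq] at heq
        rw [← Fin.snoc_init_self σ, ← Fin.snoc_init_self σ', heq.1, heq.2]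
    rw [tsum_fintype, ← Finset.sum_filter]
    calc ∑ σ ∈ Finset.univ.filter (Q k), wordNorm X φ (k + 1) 1 σ ^ (t : ℝ)
        ≤ (Finset.univ.filter (Q k)).card • ENNReal.ofReal r ^ (t : ℝ) :=
          Finset.sum_le_card_nsmul _ _ _ fun σ hσ =>
            ENNReal.rpow_le_rpow (Finset.mem_filter.1 hσ).2.1 t.coe_nonneg
      _ ≤ _ := by
          rw [nsmul_eq_mul]
          gcongr
          calc ((Finset.univ.filter (Q k)).card : ℝ≥0∞) ≤ ((T.card * Fintype.card I : ℕ) : ℝ≥0∞) :=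
                Nat.cast_le.2 hcard
            _ ≤ _ := by
                rw [Nat.cast_mul]
                gcongr
                rw [← ENNReal.ofReal_natCast]
                exact ENNReal.ofReal_le_ofReal hTcard
  have hterm : ∀ k ∈ Finset.range n, (∑' ω : Fin n → I,
      if Q k (wordPrefix (k + 1) ω) then wordNorm X φ n 1 ω ^ (t : ℝ) else 0) ≤
        A * ENNReal.ofReal r ^ (t : ℝ) * levelSum X φ n 1 t *
          (levelSum X φ (k + 1) 1 t)⁻¹ := by
    intro k hk
    obtain ⟨m, rfl⟩ := Nat.exists_eq_add_of_le (Finset.mem_range.1 hk : k + 1 ≤ n)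
    refine (h.tsum_prefix_le hX t (Q k)).trans ?_
    -- Quasi-multiplicativity in the reverse direction bounds the sum over tails by `K^t Z_n /
    -- Z_{k+1}`.
    have hZ : levelSum X φ m (1 + (k + 1)) t ≤
        (K : ℝ≥0∞) ^ (t : ℝ) * levelSum X φ (k + 1 + m) 1 t * (levelSum X φ (k + 1) 1 t)⁻¹ := by
      rw [← div_eq_mul_inv, ENNReal.le_div_iff_mul_le
        (Or.inl (h.levelSum_ne_zero hX hne le_rfl t))
        (Or.inl (h.levelSum_ne_top hX hne le_rfl t)), mul_comm]
      exact h.levelSum_mul_le hX le_rfl t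
    calc _ ≤ ENNReal.ofReal C₀ * Fintype.card I * ENNReal.ofReal r ^ (t : ℝ) *
          ((K : ℝ≥0∞) ^ (t : ℝ) * levelSum X φ (k + 1 + m) 1 t *
            (levelSum X φ (k + 1) 1 t)⁻¹) := mul_le_mul' (hQsum k) hZ
      _ = _ := by rw [hA]; ring
  calc (∑' ω : Fin n → I, if (wordMap φ n 1 ω '' X ∩ Metric.ball x r).Nonempty then
        wordNorm X φ n 1 ω ^ (t : ℝ) else 0)
      ≤ ∑' ω : Fin n → I, ∑ k ∈ Finset.range n,
          if Q k (wordPrefix (k + 1) ω) then wordNorm X φ n 1 ω ^ (t : ℝ) else 0 := by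
        refine ENNReal.tsum_le_tsum fun ω => ?_
        split_ifs with hω
        · obtain ⟨k, hk, hkQ⟩ := hex ω hω
          refine le_trans ?_ (Finset.single_le_sum (fun _ _ => zero_le) hk)
          rw [if_pos hkQ]
        · exact zero_le
    _ = ∑ k ∈ Finset.range n, ∑' ω : Fin n → I,
          if Q k (wordPrefix (k + 1) ω) then wordNorm X φ n 1 ω ^ (t : ℝ) else 0 :=
        Summable.tsum_finsetSum fun _ _ => ENNReal.summable
    _ ≤ ∑ k ∈ Finset.range n, A * ENNReal.ofReal r ^ (t : ℝ) * levelSum X φ n 1 t *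
          (levelSum X φ (k + 1) 1 t)⁻¹ := Finset.sum_le_sum hterm
    _ = A * ENNReal.ofReal r ^ (t : ℝ) * levelSum X φ n 1 t *
          ∑ k ∈ Finset.range n, (levelSum X φ (k + 1) 1 t)⁻¹ := by rw [Finset.mul_sum]
    _ ≤ A * ENNReal.ofReal r ^ (t : ℝ) * levelSum X φ n 1 t * S := by
        gcongr
        exact (ENNReal.sum_le_tsum _).trans
          (ENNReal.tsum_comp_le_tsum_of_injective (add_left_injective 1) _)
    _ = A * S * ENNReal.ofReal r ^ (t : ℝ) * levelSum X φ n 1 t := by ring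

/-- Lower bound in Bowen's formula for finite alphabets. -/
lemma IsConformalExtension.le_dimH_limitSet_of_finite [FiniteDimensional ℝ E] [Finite I]
    (h : IsConformalExtension X φ V ψ K)
    (hd : ∀ j, 1 ≤ j → ∀ a b, a ≠ b → Disjoint (φ j a '' interior X) (φ j b '' interior X))
    (hc : IsCompact X) (hne : X.Nonempty) (hcone : HasFatCones X) {η : ℝ} {M : ℕ}
    (hη : IsContracting X φ η M) {t : ℝ≥0} (hP : 0 < lowerPressure X φ t) :
    (t : ℝ≥0∞) ≤ dimH (limitSet X φ) := by
  classical
  have hX := hcone.uniqueDiffOn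
  rcases eq_zero_or_pos t with rfl | ht
  · simp
  -- With no letters the pressure would be `⊥`.
  have hI : Nonempty I := by
    by_contra hI
    rw [not_nonempty_iff] at hI
    rw [lowerPressure_eq_expGrowthInf] at hP
    have : (fun n => levelSum X φ n 1 t) =ᶠ[atTop] 0 := by
      filter_upwards [eventually_ge_atTop 1] with n hn
      have : IsEmpty (Fin n → I) := ⟨fun ω => hI.false (ω ⟨0, hn⟩)⟩
      simp [levelSum]
    rw [ExpGrowth.expGrowthInf_congr this, ExpGrowth.expGrowthInf_zero] at hP
    exact absurd hP (by simp)
  set J : ℕ → Set E := fun n => ⋃ ω : Fin (n + 1) → I, wordMap φ (n + 1) 1 ω '' X with hJdef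
  have hJeq : limitSet X φ = ⋂ n, J n := by
    ext y
    simp only [limitSet, hJdef, mem_iInter]
    constructor
    · exact fun hy n => hy (n + 1) (by omega)
    · intro hy n hn
      obtain ⟨m, rfl⟩ : ∃ m, n = m + 1 := ⟨n - 1, by omega⟩
      exact hy m
  have hJanti : Antitone J := by
    intro a b hab
    refine iUnion_subset fun ω => ?_
    exact (image_wordMap_subset h.mapsTo_base (by omega) le_rfl ω).trans
      (subset_iUnion (fun σ : Fin (a + 1) → I => wordMap φ (a + 1) 1 σ '' X) _)
  have hJc : ∀ n, IsCompact (J n) := by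
    intro n
    refine isCompact_iUnion fun ω => ?_
    refine hc.image_of_continuousOn ?_
    exact ((h.contDiffOn_word le_rfl ω).continuousOn.mono h.subset).congr
      (h.eqOn_word le_rfl ω).symm
  have hJcompact : IsCompact (limitSet X φ) := by
    rw [hJeq]
    exact (hJc 0).of_isClosed_subset (isClosed_iInter fun n => (hJc n).isClosed) (iInter_subset _ 0)
  obtain ⟨C, hC, hmass⟩ := h.exists_ball_mass_le hd hc hne hcone hP
  refine le_dimH_of_forall_finite_ball_cover hJcompact ht hC fun s x r hr hr1 hcov => ?_
  have hopen : IsOpen (⋃ j ∈ s, Metric.ball (x j) (r j)) :=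
    isOpen_biUnion fun _ _ => Metric.isOpen_ball
  -- By compactness a cover of the limit set by open balls already covers some level `J N`, so each
  -- piece of a longer word meets one of the balls.
  obtain ⟨N, hN⟩ := exists_subset_nhds_of_isCompact' (V := J)
    (directed_of_isDirected_le fun a b hab => hJanti hab) hJc (fun n => (hJc n).isClosed)
    (U := ⋃ j ∈ s, Metric.ball (x j) (r j))
    (fun y hy => hopen.mem_nhds (hcov (hJeq ▸ hy)))
  have hsmall : ∀ᶠ n : ℕ in atTop, ∀ j ∈ s, ∀ ω : Fin n → I,
      wordNorm X φ n 1 ω ≤ ENNReal.ofReal (r j) := by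
    rw [eventually_all_finset]
    intro j _
    filter_upwards [hη.eventually_wordNorm_le (ENNReal.ofReal_pos.2 (hr j))] with n hn ω
    exact hn 1 le_rfl ω
  obtain ⟨n, hnN, hn⟩ := ((eventually_ge_atTop (N + 1)).and hsmall).exists
  obtain ⟨m, rfl⟩ : ∃ m, n = m + 1 := ⟨n - 1, by omega⟩
  set Z := levelSum X φ (m + 1) 1 t with hZ
  have hZ0 : Z ≠ 0 := h.levelSum_ne_zero hX hne le_rfl t
  have hZtop : Z ≠ ∞ := h.levelSum_ne_top hX hne le_rfl t
  have hmeet : ∀ ω : Fin (m + 1) → I, ∃ j ∈ s,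
      (wordMap φ (m + 1) 1 ω '' X ∩ Metric.ball (x j) (r j)).Nonempty := by
    intro ω
    obtain ⟨y, hy⟩ := hne
    have hyJ : wordMap φ (m + 1) 1 ω y ∈ J m := mem_iUnion.2 ⟨ω, y, hy, rfl⟩
    obtain ⟨j, hj, hyj⟩ := mem_iUnion₂.1 (hN (hJanti (by omega : N ≤ m) hyJ))
    exact ⟨j, hj, _, ⟨y, hy, rfl⟩, hyj⟩
  have hle : 1 * Z ≤ (C * ∑ j ∈ s, ENNReal.ofReal (r j) ^ (t : ℝ)) * Z := by
    calc 1 * Z = ∑' ω : Fin (m + 1) → I, wordNorm X φ (m + 1) 1 ω ^ (t : ℝ) := one_mul _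
      _ ≤ ∑' ω : Fin (m + 1) → I, ∑ j ∈ s,
            if (wordMap φ (m + 1) 1 ω '' X ∩ Metric.ball (x j) (r j)).Nonempty then
              wordNorm X φ (m + 1) 1 ω ^ (t : ℝ) else 0 := by
          refine ENNReal.tsum_le_tsum fun ω => ?_
          obtain ⟨j, hj, hω⟩ := hmeet ω
          refine le_trans ?_ (Finset.single_le_sum (fun _ _ => zero_le) hj)
          rw [if_pos hω]
      _ = ∑ j ∈ s, ∑' ω : Fin (m + 1) → I,
            if (wordMap φ (m + 1) 1 ω '' X ∩ Metric.ball (x j) (r j)).Nonempty then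
              wordNorm X φ (m + 1) 1 ω ^ (t : ℝ) else 0 :=
          Summable.tsum_finsetSum fun _ _ => ENNReal.summable
      _ ≤ ∑ j ∈ s, C * ENNReal.ofReal (r j) ^ (t : ℝ) * Z :=
          Finset.sum_le_sum fun j hj => hmass (x j) (r j) (hr j) (hr1 j) (m + 1) (hn j hj)
      _ = (C * ∑ j ∈ s, ENNReal.ofReal (r j) ^ (t : ℝ)) * Z := by
          rw [Finset.mul_sum, Finset.sum_mul]
  exact (ENNReal.mul_le_mul_iff_left hZ0 hZtop).1 hle

end LevelSums

lemma limitSet_reindex_subset {E I I' : Type*} (X : Set E) (φ : ℕ → I → E → E) (e : I' → I) :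
    limitSet X (fun j i => φ j (e i)) ⊆ limitSet X φ := by
  refine iInter₂_mono fun n _ => iUnion_subset fun ω => ?_
  rw [wordMap_reindex]
  exact subset_iUnion (fun σ : Fin n → I => wordMap φ n 1 σ '' X) (e ∘ ω)

/-! ### Subsystems on fewer letters -/

section Subsystems

variable {E I I' : Type*} [NormedAddCommGroup E] [InnerProductSpace ℝ E]
  {X V : Set E} {φ ψ : ℕ → I → E → E} {K : ℝ≥0}

lemma wordNorm_reindex (X : Set E) (φ : ℕ → I → E → E) (e : I' → I) (n k : ℕ) (ω : Fin n → I') :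
    wordNorm X (fun j i => φ j (e i)) n k ω = wordNorm X φ n k (e ∘ ω) := by
  rw [wordNorm, wordNorm, wordMap_reindex]

lemma IsConformalExtension.reindex (h : IsConformalExtension X φ V ψ K) (e : I' → I) :
    IsConformalExtension X (fun j i => φ j (e i)) V (fun j i => ψ j (e i)) K where
  mapsTo_base j hj i := h.mapsTo_base j hj (e i)
  isOpen := h.isOpen
  isConnected := h.isConnected
  subset := h.subset
  eqOn j hj i := h.eqOn j hj (e i)
  mapsTo j hj i := h.mapsTo j hj (e i)
  injOn j hj i := h.injOn j hj (e i)
  contDiffOn j hj i := h.contDiffOn j hj (e i)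
  conformalAt j hj i := h.conformalAt j hj (e i)
  one_le := h.one_le
  distortion n k hk ω := by
    rw [wordMap_reindex]
    exact h.distortion n k hk (e ∘ ω)

lemma IsContracting.reindex {η : ℝ} {M : ℕ} (h : IsContracting X φ η M) (e : I' → I) :
    IsContracting X (fun j i => φ j (e i)) η M :=
  ⟨h.1, h.2.1, fun m hm k hk ω => by rw [wordNorm_reindex]; exact h.2.2 m hm k hk _⟩

lemma levelSum_reindex (X : Set E) (φ : ℕ → I → E → E) (e : I' → I) (n k : ℕ) (t : ℝ≥0) :
    levelSum X (fun j i => φ j (e i)) n k t =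
      ∑' ω : Fin n → I', wordNorm X φ n k (e ∘ ω) ^ (t : ℝ) := by
  simp only [levelSum, wordNorm_reindex]

end Subsystems

/-! ### Substituting letters from a finite subalphabet -/

section Substitution

variable {I : Type*}

lemma tsum_cons {n : ℕ} (f : (Fin (n + 1) → I) → ℝ≥0∞) :
    ∑' ω, f ω = ∑' i : I, ∑' τ : Fin n → I, f (Fin.cons i τ) := by
  rw [← (Fin.consEquiv fun _ => I).tsum_eq f, ENNReal.tsum_prod']
  rfl

/-- If, at each position, summing a weight over all letters is bounded by `c` times the sum over
the letters in `F`, then the total weight of words of length `n` is bounded by `c ^ n` times the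
total weight of the words in the letters of `F`. -/
lemma tsum_words_le_of_substitution [Nonempty I] (F : Finset I) (c : ℝ≥0∞) {n : ℕ}
    (w : (Fin n → I) → ℝ≥0∞)
    (h : ∀ j ω, ∑' i, w (Function.update ω j i) ≤ c * ∑' i : F, w (Function.update ω j i)) :
    ∑' ω, w ω ≤ c ^ n * ∑' ω : Fin n → F, w (Subtype.val ∘ ω) := by
  induction n with
  | zero =>
    rw [pow_zero, one_mul, tsum_fintype, tsum_fintype, Fintype.sum_unique, Fintype.sum_unique]
    refine le_of_eq (congrArg w (Subsingleton.elim _ _))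
  | succ n ih =>
    have hcons : ∀ (i : F) (τ : Fin n → F), (Fin.cons (i : I) (Subtype.val ∘ τ) : Fin (n + 1) → I) =
        Subtype.val ∘ (Fin.cons i τ : Fin (n + 1) → F) := by
      intro i τ
      funext x
      refine Fin.cases rfl (fun y => rfl) x
    calc ∑' ω, w ω = ∑' i : I, ∑' τ : Fin n → I, w (Fin.cons i τ) := tsum_cons w
      _ ≤ ∑' i : I, c ^ n * ∑' τ : Fin n → F, w (Fin.cons i (Subtype.val ∘ τ)) := by
          refine ENNReal.tsum_le_tsum fun i => ih (fun τ => w (Fin.cons i τ)) fun j τ => ?_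
          simp only [Fin.cons_update]
          exact h j.succ _
      _ = c ^ n * ∑' τ : Fin n → F, ∑' i : I, w (Fin.cons i (Subtype.val ∘ τ)) := by
          rw [ENNReal.tsum_mul_left, ENNReal.tsum_comm]
      _ ≤ c ^ n * ∑' τ : Fin n → F, c * ∑' i : F, w (Fin.cons i (Subtype.val ∘ τ)) := by
          gcongr with τ
          -- The arbitrary first letter is overwritten by the update at position 0.
          have := h 0 (Fin.cons (Classical.arbitrary I) (Subtype.val ∘ τ))
          simpa only [Fin.update_cons_zero] using this
      _ = c ^ (n + 1) * ∑' i : F, ∑' τ : Fin n → F, w (Subtype.val ∘ Fin.cons i τ) := by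
          simp only [hcons]
          rw [ENNReal.tsum_mul_left, ENNReal.tsum_comm, pow_succ, mul_assoc]
      _ = _ := by rw [tsum_cons]

/-- The blocks `A` and `B` around position `j` do not depend on the new letter `i`, so words
differing at `j` alone can be compared block by block. -/
lemma exists_update_eq_append {n : ℕ} (j : Fin n) (ω : Fin n → I) :
    ∃ (p q : ℕ) (hn : p + 1 + q = n) (A : Fin p → I) (B : Fin q → I), ∀ i,
      Function.update ω j i = Fin.append (Fin.append A fun _ : Fin 1 => i) B ∘ Fin.cast hn.symm := by
  obtain ⟨p, hp⟩ := j
  obtain ⟨q, rfl⟩ : ∃ q, n = p + 1 + q := ⟨n - (p + 1), by omega⟩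
  refine ⟨p, q, rfl, fun x => ω (Fin.castAdd q (Fin.castAdd 1 x)), fun x => ω (Fin.natAdd (p + 1) x),
    fun i => ?_⟩
  funext x
  simp only [Fin.cast_refl, Function.comp_apply, id_eq]
  refine Fin.addCases (fun y => ?_) (fun y => ?_) x
  · rw [Fin.append_left]
    refine Fin.addCases (fun z => ?_) (fun z => ?_) y
    · rw [Fin.append_left, Function.update_of_ne]
      simp only [ne_eq, Fin.ext_iff, Fin.val_castAdd]
      omega
    · rw [Fin.append_right]
      convert Function.update_self (⟨p, hp⟩ : Fin (p + 1 + q)) i ω using 2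
      ext
      simp
  · rw [Fin.append_right, Function.update_of_ne]
    simp only [ne_eq, Fin.ext_iff, Fin.val_natAdd]
    omega

end Substitution

/-! ### Criteria for positive growth -/

section GrowthCriteria

/-- The growth is split in two halves: one factor `b ^ n` is spent on passing to a finite alphabet,
the other keeps the pressure positive. -/
lemma ExpGrowth.exists_pow_le_of_pos {u : ℕ → ℝ≥0∞} (h : 0 < ExpGrowth.expGrowthInf u) :
    ∃ b : ℝ≥0∞, 1 < b ∧ b ≠ ∞ ∧ ∀ᶠ n : ℕ in atTop, b ^ n * b ^ n ≤ u n := by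
  obtain ⟨c, hc0, hcP⟩ := EReal.lt_iff_exists_real_btwn.1 h
  have hc : 0 < c := by exact_mod_cast hc0
  refine ⟨ENNReal.ofReal (Real.exp (c / 2)), ?_, ENNReal.ofReal_ne_top, ?_⟩
  · rw [← ENNReal.ofReal_one]
    exact (ENNReal.ofReal_lt_ofReal_iff (Real.exp_pos _)).2 (by simpa using hc)
  · filter_upwards [ExpGrowth.eventually_exp_le hcP] with n hn
    refine le_trans (le_of_eq ?_) hn
    rw [← mul_pow, ← ENNReal.ofReal_mul (Real.exp_pos _).le, ← Real.exp_add, add_halves,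
      ← ENNReal.ofReal_pow (Real.exp_pos _).le, ← Real.exp_nat_mul, ← EReal.exp_coe]
    congr 1
    rw [mul_comm, EReal.coe_mul]
    rfl

lemma ExpGrowth.pos_of_pow_le {u : ℕ → ℝ≥0∞} {b : ℝ≥0∞} (hb : 1 < b)
    (h : ∀ᶠ n : ℕ in atTop, b ^ n ≤ u n) : 0 < ExpGrowth.expGrowthInf u := by
  refine lt_of_lt_of_le ?_ (ExpGrowth.expGrowthInf_eventually_monotone h)
  rw [ExpGrowth.expGrowthInf_pow, ← ENNReal.log_one]
  exact ENNReal.log_strictMono hb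

end GrowthCriteria

/-! ### Lower bound for infinite alphabets -/

section LowerBound

variable {E I : Type*} [NormedAddCommGroup E] [InnerProductSpace ℝ E] [Nontrivial E]
  {X V : Set E} {φ ψ : ℕ → I → E → E} {K : ℝ≥0}

/-- Replacing the letter `i` of a word by `o` costs at most a constant times the quotient of the
sizes of the two letters. -/
lemma IsConformalExtension.wordNorm_update_mul_le (h : IsConformalExtension X φ V ψ K)
    (hX : UniqueDiffOn ℝ X) {a : I → ℝ≥0∞} {D : ℝ≥0∞}
    (hlow : ∀ j, 1 ≤ j → ∀ i, a i ≤ wordNorm X φ 1 j fun _ => i)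
    (hup : ∀ j, 1 ≤ j → ∀ i, (wordNorm X φ 1 j fun _ => i) ≤ D * a i)
    {n : ℕ} (ω : Fin n → I) (j : Fin n) (i o : I) :
    wordNorm X φ n 1 (Function.update ω j i) * a o ≤
      K * K * D * a i * wordNorm X φ n 1 (Function.update ω j o) := by
  obtain ⟨p, q, rfl, A, B, hAB⟩ := exists_update_eq_append j ω
  simp only [Fin.cast_refl, Function.comp_id] at hAB
  rw [hAB, hAB]
  set NA := wordNorm X φ p 1 A
  set NB := wordNorm X φ q (1 + (p + 1)) B
  have h1 : wordNorm X φ (p + 1 + q) 1 (Fin.append (Fin.append A fun _ : Fin 1 => i) B) ≤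
      NA * (D * a i) * NB := by
    refine (h.wordNorm_append_le hX le_rfl _ _).trans ?_
    gcongr
    refine (h.wordNorm_append_le hX le_rfl _ _).trans ?_
    gcongr
    exact hup _ (by omega) i
  -- The two joins around the letter cost one factor `K` each.
  have h2 : NA * a o * NB ≤
      K * K * wordNorm X φ (p + 1 + q) 1 (Fin.append (Fin.append A fun _ : Fin 1 => o) B) := by
    calc NA * a o * NB ≤ NA * (wordNorm X φ 1 (1 + p) fun _ => o) * NB := by
          gcongr
          exact hlow _ (by omega) o
      _ ≤ K * wordNorm X φ (p + 1) 1 (Fin.append A fun _ : Fin 1 => o) * NB := by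
          exact mul_le_mul' (h.wordNorm_mul_le hX le_rfl A _) le_rfl
      _ ≤ _ := by
          rw [mul_assoc, mul_assoc]
          exact mul_le_mul' le_rfl (h.wordNorm_mul_le hX le_rfl _ B)
  calc _ ≤ NA * (D * a i) * NB * a o := by gcongr
    _ = D * a i * (NA * a o * NB) := by ring
    _ ≤ D * a i * (K * K * wordNorm X φ (p + 1 + q) 1
          (Fin.append (Fin.append A fun _ : Fin 1 => o) B)) := by gcongr
    _ = _ := by ring

/-- Each letter outside `F` is traded for `o ∈ F`; the total cost is proportional to the tail of `∑
a_i ^ t`, which tends to 0 as `F` grows when this series converges. -/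
lemma IsConformalExtension.tsum_update_le (h : IsConformalExtension X φ V ψ K)
    (hX : UniqueDiffOn ℝ X) {a : I → ℝ≥0∞} {D : ℝ≥0∞}
    (hlow : ∀ j, 1 ≤ j → ∀ i, a i ≤ wordNorm X φ 1 j fun _ => i)
    (hup : ∀ j, 1 ≤ j → ∀ i, (wordNorm X φ 1 j fun _ => i) ≤ D * a i)
    {F : Finset I} {o : I} (ho : o ∈ F) (ho0 : a o ≠ 0) (hotop : a o ≠ ∞) (t : ℝ≥0)
    {n : ℕ} (ω : Fin n → I) (j : Fin n) :
    ∑' i, wordNorm X φ n 1 (Function.update ω j i) ^ (t : ℝ) ≤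
      (1 + (K * K * D * (a o)⁻¹) ^ (t : ℝ) * ∑' i : {i // i ∉ F}, a i ^ (t : ℝ)) *
        ∑' i : F, wordNorm X φ n 1 (Function.update ω j i) ^ (t : ℝ) := by
  set w : I → ℝ≥0∞ := fun i => wordNorm X φ n 1 (Function.update ω j i) ^ (t : ℝ) with hw
  have hsplit : ∑' i, w i = ∑' i : F, w i + ∑' i : {i // i ∉ F}, w i :=
    (ENNReal.summable.tsum_add_tsum_compl (s := (F : Set I)) ENNReal.summable).symm
  have hwo : w o ≤ ∑' i : F, w i := ENNReal.le_tsum (f := fun i : F => w i) ⟨o, ho⟩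
  have hwi : ∀ i, w i ≤ (K * K * D * (a o)⁻¹) ^ (t : ℝ) * a i ^ (t : ℝ) * w o := by
    intro i
    simp only [hw, ← ENNReal.mul_rpow_of_nonneg _ _ t.coe_nonneg]
    refine ENNReal.rpow_le_rpow ?_ t.coe_nonneg
    have := h.wordNorm_update_mul_le hX hlow hup ω j i o
    rw [← ENNReal.le_div_iff_mul_le (Or.inl ho0) (Or.inl hotop)] at this
    refine this.trans_eq ?_
    rw [div_eq_mul_inv]
    ring
  change ∑' i, w i ≤ _
  rw [hsplit, add_mul, one_mul]
  gcongr
  calc ∑' i : {i // i ∉ F}, w i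
      ≤ ∑' i : {i // i ∉ F}, (K * K * D * (a o)⁻¹) ^ (t : ℝ) * a i ^ (t : ℝ) * w o :=
        ENNReal.tsum_le_tsum fun i => hwi i
    _ = (K * K * D * (a o)⁻¹) ^ (t : ℝ) * (∑' i : {i // i ∉ F}, a i ^ (t : ℝ)) * w o := by
        rw [ENNReal.tsum_mul_right, ENNReal.tsum_mul_left]
    _ ≤ _ := by gcongr

/-- Appending a level loses a factor `K ^ t` to distortion, which the assumption on each level
compensates in advance. -/
lemma IsConformalExtension.pow_le_levelSum (h : IsConformalExtension X φ V ψ K)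
    (hX : UniqueDiffOn ℝ X) (hne : X.Nonempty) {t : ℝ≥0} {B : ℝ≥0∞}
    (hB : ∀ k, 1 ≤ k → (K : ℝ≥0∞) ^ (t : ℝ) * B ≤ levelSum X φ 1 k t) (n : ℕ) :
    B ^ n ≤ levelSum X φ n 1 t := by
  have hK0 : (K : ℝ≥0∞) ≠ 0 := by
    have := h.one_le
    exact ENNReal.coe_ne_zero.2 (by positivity)
  have hKt0 : (K : ℝ≥0∞) ^ (t : ℝ) ≠ 0 :=
    (ENNReal.rpow_pos (pos_iff_ne_zero.2 hK0) ENNReal.coe_ne_top).ne'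
  have hKt : (K : ℝ≥0∞) ^ (t : ℝ) ≠ ∞ :=
    ENNReal.rpow_ne_top_of_nonneg t.coe_nonneg ENNReal.coe_ne_top
  induction n with
  | zero =>
    rw [pow_zero, levelSum, tsum_fintype, Fintype.sum_unique]
    simpa using ENNReal.rpow_le_rpow (h.one_le_wordNorm_zero hX hne _) t.coe_nonneg
  | succ n ih =>
    rw [← ENNReal.mul_le_mul_iff_right hKt0 hKt]
    calc (K : ℝ≥0∞) ^ (t : ℝ) * B ^ (n + 1) = B ^ n * ((K : ℝ≥0∞) ^ (t : ℝ) * B) := by ring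
      _ ≤ levelSum X φ n 1 t * levelSum X φ 1 (1 + n) t := mul_le_mul' ih (hB _ (by omega))
      _ ≤ _ := h.levelSum_mul_le hX le_rfl t

/-- Lower bound in Bowen's formula for a countable alphabet whose letters have a size that does not
depend on the level, up to a bounded factor. -/
lemma IsConformalExtension.le_dimH_limitSet_of_comparable [FiniteDimensional ℝ E]
    (h : IsConformalExtension X φ V ψ K)
    (hd : ∀ j, 1 ≤ j → ∀ a b, a ≠ b → Disjoint (φ j a '' interior X) (φ j b '' interior X))
    (hc : IsCompact X) (hne : X.Nonempty) (hcone : HasFatCones X) {η : ℝ} {M : ℕ}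
    (hη : IsContracting X φ η M) [Nonempty I] {a : I → ℝ≥0∞} {D : ℝ≥0∞} (hD : D ≠ ∞)
    (ha0 : ∀ i, a i ≠ 0) (hatop : ∀ i, a i ≠ ∞)
    (hlow : ∀ j, 1 ≤ j → ∀ i, a i ≤ wordNorm X φ 1 j fun _ => i)
    (hup : ∀ j, 1 ≤ j → ∀ i, (wordNorm X φ 1 j fun _ => i) ≤ D * a i)
    {t : ℝ≥0} (hP : 0 < lowerPressure X φ t) :
    (t : ℝ≥0∞) ≤ dimH (limitSet X φ) := by
  have hX := hcone.uniqueDiffOn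
  suffices hF : ∃ F : Finset I, 0 < lowerPressure X (fun j (i : F) => φ j i) t by
    obtain ⟨F, hF⟩ := hF
    refine le_trans ?_ (dimH_mono (limitSet_reindex_subset X φ (Subtype.val : F → I)))
    refine (h.reindex (Subtype.val : F → I)).le_dimH_limitSet_of_finite ?_ hc hne hcone
      (hη.reindex _) hF
    exact fun j hj x y hxy => hd j hj x y fun hxy' => hxy (Subtype.ext hxy')
  simp only [lowerPressure_eq_expGrowthInf] at hP ⊢
  -- If the series diverges, a finite part exceeds `2 K ^ t` and gives sums at least `2 ^ n`
  -- whatever the level.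
  by_cases hsum : ∑' i, a i ^ (t : ℝ) = ∞
  · have hKt : (K : ℝ≥0∞) ^ (t : ℝ) * 2 ≠ ∞ :=
      ENNReal.mul_ne_top (ENNReal.rpow_ne_top_of_nonneg t.coe_nonneg ENNReal.coe_ne_top) (by simp)
    have hlt : (K : ℝ≥0∞) ^ (t : ℝ) * 2 < ∑' i, a i ^ (t : ℝ) := by
      rw [hsum]
      exact hKt.lt_top
    rw [ENNReal.tsum_eq_iSup_sum, lt_iSup_iff] at hlt
    obtain ⟨F, hF⟩ := hlt
    refine ⟨F, ExpGrowth.pos_of_pow_le (b := 2) (by norm_num) (Eventually.of_forall fun n => ?_)⟩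
    refine (h.reindex (Subtype.val : F → I)).pow_le_levelSum hX hne (fun k hk => ?_) n
    refine hF.le.trans ?_
    rw [levelSum_reindex, ← (Equiv.funUnique (Fin 1) F).symm.tsum_eq, ← Finset.tsum_subtype]
    exact ENNReal.tsum_le_tsum fun i => ENNReal.rpow_le_rpow (hlow k hk i) t.coe_nonneg
  · obtain ⟨b, hb1, hbtop, hb⟩ := ExpGrowth.exists_pow_le_of_pos hP
    set o := Classical.arbitrary I
    set κ := (K * K * D * (a o)⁻¹) ^ (t : ℝ) with hκ
    have hκtop : κ ≠ ∞ := by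
      refine ENNReal.rpow_ne_top_of_nonneg t.coe_nonneg ?_
      exact ENNReal.mul_ne_top (ENNReal.mul_ne_top (ENNReal.mul_ne_top ENNReal.coe_ne_top
        ENNReal.coe_ne_top) hD) (ENNReal.inv_ne_top.2 (ha0 o))
    have hlim : Tendsto (fun F : Finset I => 1 + κ * ∑' i : {i // i ∉ F}, a i ^ (t : ℝ)) atTop
        (𝓝 (1 + κ * 0)) :=
      tendsto_const_nhds.add (ENNReal.Tendsto.const_mul
        (ENNReal.tendsto_tsum_compl_atTop_zero hsum) (Or.inr hκtop))
    rw [mul_zero, add_zero] at hlim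
    -- The substitution cost per position is at most `b`, so of `Z_n ≥ b ^ n * b ^ n` at least `b ^
    -- n` remains on `F`.
    obtain ⟨F, hFb, hFo⟩ := ((hlim.eventually_le_const hb1).and (eventually_ge_atTop {o})).exists
    refine ⟨F, ExpGrowth.pos_of_pow_le hb1 ?_⟩
    filter_upwards [hb] with n hn
    have hsub := tsum_words_le_of_substitution F b
      (fun ω : Fin n → I => wordNorm X φ n 1 ω ^ (t : ℝ)) fun j ω =>
        (h.tsum_update_le hX hlow hup (Finset.singleton_subset_iff.1 hFo) (ha0 o) (hatop o) t
          ω j).trans (mul_le_mul_left hFb _)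
    have hbn : b ^ n ≠ 0 := pow_ne_zero n (zero_lt_one.trans hb1).ne'
    rw [← ENNReal.mul_le_mul_iff_right hbn (ENNReal.pow_ne_top hbtop), levelSum_reindex]
    exact hn.trans hsub

end LowerBound

/-! ### Growth rates under index shifts -/

section Growth

lemma ExpGrowth.expGrowthInf_le_of_forall_exp {u v : ℕ → ℝ≥0∞}
    (h : ∀ c : ℝ, (∀ᶠ n : ℕ in atTop, EReal.exp ((c : EReal) * n) ≤ u n) →
      ∃ b : ℝ≥0∞, b ≠ 0 ∧ ∀ᶠ n : ℕ in atTop, b * EReal.exp ((c : EReal) * n) ≤ v n) :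
    ExpGrowth.expGrowthInf u ≤ ExpGrowth.expGrowthInf v := by
  refine le_of_forall_lt_imp_le_of_dense fun a ha => ?_
  obtain ⟨c, hac, hcu⟩ := EReal.lt_iff_exists_real_btwn.1 ha
  obtain ⟨b, hb, hv⟩ := h c (ExpGrowth.eventually_exp_le hcu)
  refine hac.le.trans ?_
  rw [← ExpGrowth.expGrowthInf_exp (a := (c : EReal))]
  exact ExpGrowth.expGrowthInf_of_eventually_ge hb hv

lemma EReal.exp_mul_natCast_succ (c : ℝ) (n : ℕ) :
    EReal.exp ((c : EReal) * ((n + 1 : ℕ) : EReal)) = EReal.exp c * EReal.exp ((c : EReal) * n) := by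
  have h : ∀ k : ℕ, (c : EReal) * (k : EReal) = ((c * k : ℝ) : EReal) := fun k => by
    rw [EReal.coe_mul]; rfl
  rw [h, h, EReal.exp_coe, EReal.exp_coe, EReal.exp_coe, ← ENNReal.ofReal_mul (Real.exp_pos _).le,
    ← Real.exp_add]
  congr 2
  push_cast
  ring

lemma EReal.exp_coe_ne_zero (c : ℝ) : EReal.exp c ≠ 0 := by
  rw [EReal.exp_coe]
  exact (ENNReal.ofReal_pos.2 (Real.exp_pos c)).ne'

lemma EReal.exp_coe_ne_top (c : ℝ) : EReal.exp c ≠ ∞ := by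
  rw [EReal.exp_coe]
  exact ENNReal.ofReal_ne_top

lemma ExpGrowth.expGrowthInf_le_of_mul_le_succ {u v : ℕ → ℝ≥0∞} {b : ℝ≥0∞} (hb : b ≠ 0)
    (h : ∀ n, b * u n ≤ v (n + 1)) : ExpGrowth.expGrowthInf u ≤ ExpGrowth.expGrowthInf v := by
  refine ExpGrowth.expGrowthInf_le_of_forall_exp fun c hc => ⟨b * (EReal.exp c)⁻¹,
    mul_ne_zero hb (ENNReal.inv_ne_zero.2 (EReal.exp_coe_ne_top c)), ?_⟩
  obtain ⟨N, hN⟩ := eventually_atTop.1 hc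
  filter_upwards [eventually_ge_atTop (N + 1)] with n hn
  obtain ⟨k, rfl⟩ : ∃ k, n = k + 1 := ⟨n - 1, by omega⟩
  refine le_trans (le_of_eq ?_) ((mul_le_mul' le_rfl (hN k (by omega))).trans (h k))
  rw [EReal.exp_mul_natCast_succ, mul_assoc, ← mul_assoc _⁻¹,
    ENNReal.inv_mul_cancel (EReal.exp_coe_ne_zero c) (EReal.exp_coe_ne_top c), one_mul]

lemma ExpGrowth.expGrowthInf_le_of_succ_mul_le {u v : ℕ → ℝ≥0∞} {b : ℝ≥0∞} (hb : b ≠ 0)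
    (h : ∀ n, b * u (n + 1) ≤ v n) : ExpGrowth.expGrowthInf u ≤ ExpGrowth.expGrowthInf v := by
  refine ExpGrowth.expGrowthInf_le_of_forall_exp fun c hc => ⟨b * EReal.exp c,
    mul_ne_zero hb (EReal.exp_coe_ne_zero c), ?_⟩
  filter_upwards [(tendsto_add_atTop_nat 1).eventually hc] with n hn
  refine le_trans (le_of_eq ?_) ((mul_le_mul' le_rfl hn).trans (h n))
  rw [EReal.exp_mul_natCast_succ, mul_assoc]

end Growth

/-! ### Invariance of the pressure under the shift -/

section Shift

variable {E I : Type*} [NormedAddCommGroup E] [InnerProductSpace ℝ E] [Nontrivial E]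
  {X V : Set E} {φ ψ : ℕ → I → E → E} {K : ℝ≥0}

lemma levelSum_shift {E I : Type*} [NormedAddCommGroup E] [NormedSpace ℝ E] (X : Set E)
    (φ : ℕ → I → E → E) (n k : ℕ) (t : ℝ≥0) :
    levelSum X (fun j => φ (j + 1)) n k t = levelSum X φ n (k + 1) t := by
  simp only [levelSum, wordNorm, wordMap_shift]

/-- Dropping the first level changes the sums by a factor between `Z_1` and `Z_1 / K ^ t`, which is
harmless for the growth rate when `Z_1` is neither 0 nor `∞`. -/
lemma IsConformalExtension.lowerPressure_shift (h : IsConformalExtension X φ V ψ K)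
    (hX : UniqueDiffOn ℝ X) {t : ℝ≥0} (h0 : levelSum X φ 1 1 t ≠ 0)
    (htop : levelSum X φ 1 1 t ≠ ∞) :
    lowerPressure X (fun j => φ (j + 1)) t = lowerPressure X φ t := by
  have hKtop : (K : ℝ≥0∞) ^ (t : ℝ) ≠ ∞ :=
    ENNReal.rpow_ne_top_of_nonneg t.coe_nonneg ENNReal.coe_ne_top
  simp only [lowerPressure_eq_expGrowthInf, levelSum_shift]
  refine le_antisymm ?_ ?_
  · refine ExpGrowth.expGrowthInf_le_of_mul_le_succ
      (b := ((K : ℝ≥0∞) ^ (t : ℝ))⁻¹ * levelSum X φ 1 1 t)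
      (mul_ne_zero (ENNReal.inv_ne_zero.2 hKtop) h0) fun n => ?_
    rw [mul_assoc, ← ENNReal.div_eq_inv_mul]
    refine ENNReal.div_le_of_le_mul' ?_
    rw [add_comm n 1]
    exact h.levelSum_mul_le hX le_rfl t
  · refine ExpGrowth.expGrowthInf_le_of_succ_mul_le (b := (levelSum X φ 1 1 t)⁻¹)
      (ENNReal.inv_ne_zero.2 htop) fun n => ?_
    rw [← ENNReal.div_eq_inv_mul]
    refine ENNReal.div_le_of_le_mul' ?_
    rw [add_comm n 1]
    exact h.levelSum_add_le hX le_rfl t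

lemma IsConformalExtension.lowerPressure_eq_top [Nonempty I] (h : IsConformalExtension X φ V ψ K)
    (hX : UniqueDiffOn ℝ X) (hne : X.Nonempty) {t : ℝ≥0} (htop : levelSum X φ 1 1 t = ∞) :
    lowerPressure X φ t = ⊤ := by
  rw [lowerPressure_eq_expGrowthInf, ← ExpGrowth.expGrowthInf_top]
  refine ExpGrowth.expGrowthInf_congr ?_
  filter_upwards [eventually_ge_atTop 1] with n hn
  obtain ⟨m, rfl⟩ := Nat.exists_eq_add_of_le hn
  have := h.levelSum_mul_le hX (a := 1) (b := m) le_rfl t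
  rw [htop, ENNReal.top_mul (h.levelSum_ne_zero hX hne (by omega) t), top_le_iff] at this
  by_contra hfin
  exact ENNReal.mul_ne_top (ENNReal.rpow_ne_top_of_nonneg t.coe_nonneg ENNReal.coe_ne_top) hfin this

lemma lowerPressure_of_isEmpty {E I : Type*} [NormedAddCommGroup E] [NormedSpace ℝ E] [IsEmpty I]
    (X : Set E) (φ : ℕ → I → E → E) (t : ℝ≥0) : lowerPressure X φ t = ⊥ := by
  rw [lowerPressure_eq_expGrowthInf, ← ExpGrowth.expGrowthInf_zero]
  refine ExpGrowth.expGrowthInf_congr ?_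
  filter_upwards [eventually_ge_atTop 1] with n hn
  have : IsEmpty (Fin n → I) := ⟨fun ω => isEmptyElim (ω ⟨0, hn⟩)⟩
  simp [levelSum]

lemma levelSum_one {E I : Type*} [NormedAddCommGroup E] [NormedSpace ℝ E]
    (X : Set E) (φ : ℕ → I → E → E) (k : ℕ) (t : ℝ≥0) :
    levelSum X φ 1 k t = ∑' i, derivNorm X (φ k i) ^ (t : ℝ) := by
  rw [levelSum, ← (Equiv.funUnique (Fin 1) I).symm.tsum_eq]
  rfl

end Shift

/-! ### Expectation of an almost surely constant variable -/

section Expectation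

/-- Positive or negative part of a constant vanishes, so the difference is never `∞ - ∞`, even for
`c = ⊤` or `c = ⊥`. -/
lemma erealExpectation_of_ae_eq_const {Λ : Type*} [MeasurableSpace Λ] {m : Measure Λ}
    [IsProbabilityMeasure m] {f : Λ → EReal} {c : EReal} (h : ∀ᵐ lam ∂m, f lam = c) :
    erealExpectation m f = c := by
  have h1 : ∫⁻ lam, (f lam).toENNReal ∂m = c.toENNReal := by
    rw [lintegral_congr_ae (g := fun _ => c.toENNReal) (h.mono fun lam hl => by simp only [hl])]
    simp
  have h2 : ∫⁻ lam, (-f lam).toENNReal ∂m = (-c).toENNReal := by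
    rw [lintegral_congr_ae (g := fun _ => (-c).toENNReal) (h.mono fun lam hl => by simp only [hl])]
    simp
  rw [erealExpectation, h1, h2]
  rcases le_total 0 c with hc | hc
  · rw [EReal.toENNReal_of_nonpos (x := -c) (by simpa using hc), EReal.coe_toENNReal hc]
    simp
  · rw [EReal.toENNReal_of_nonpos hc, EReal.coe_toENNReal (x := -c) (by simpa using hc)]
    simp

end Expectation

/-! ### Random systems: measurability, ergodicity, comparability -/

section Random

variable {d : ℕ} {Λ I : Type*} [MeasurableSpace Λ]
  {m : Measure Λ} {T : Λ ≃ᵐ Λ} {X : Set (EuclideanSpace ℝ (Fin d))}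
  {φ : Λ → I → EuclideanSpace ℝ (Fin d) → EuclideanSpace ℝ (Fin d)}

lemma fiberSystem_shift (T : Λ ≃ᵐ Λ)
    (φ : Λ → I → EuclideanSpace ℝ (Fin d) → EuclideanSpace ℝ (Fin d)) (lam : Λ) :
    fiberSystem T φ (T lam) = fun j => fiberSystem T φ lam (j + 1) := rfl

/-- Levels start at 1, so the maps over `lam` itself are the first level of the fibre over `T.symm
lam`. Invertibility of `T` thus transfers the fibre axioms to every `φ lam`. -/
lemma fiberSystem_symm_one (T : Λ ≃ᵐ Λ)
    (φ : Λ → I → EuclideanSpace ℝ (Fin d) → EuclideanSpace ℝ (Fin d)) (lam : Λ) :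
    fiberSystem T φ (T.symm lam) 1 = φ lam := by
  funext i
  simp [fiberSystem]

namespace IsRandomCIFS

lemma mapsTo (hφ : IsRandomCIFS X m T φ) (lam : Λ) (i : I) : MapsTo (φ lam i) X X := by
  have := (hφ.isNCIFS (T.symm lam)).mapsTo 1 le_rfl i
  rwa [fiberSystem_symm_one] at this

lemma continuousOn (hφ : IsRandomCIFS X m T φ) (lam : Λ) (i : I) : ContinuousOn (φ lam i) X := by
  obtain ⟨V, ψ, K, h⟩ := (hφ.isNCIFS (T.symm lam)).exists_extension
  rw [← fiberSystem_symm_one T φ lam]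
  exact (((h.contDiffOn 1 le_rfl i).continuousOn).mono h.subset).congr (h.eqOn 1 le_rfl i).symm

lemma derivNorm_ne_top (hφ : IsRandomCIFS X m T φ) (hX : IsPhaseSpace X) (lam : Λ) (i : I) :
    derivNorm X (φ lam i) ≠ ∞ := by
  obtain ⟨V, ψ, K, h⟩ := (hφ.isNCIFS (T.symm lam)).exists_extension
  have := h.wordNorm_ne_top hX.hasFatCones.uniqueDiffOn hX.nonempty le_rfl (fun _ : Fin 1 => i)
  rw [← fiberSystem_symm_one T φ lam]
  exact this

lemma derivNorm_ne_zero [Nontrivial (EuclideanSpace ℝ (Fin d))] (hφ : IsRandomCIFS X m T φ)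
    (hX : IsPhaseSpace X) (lam : Λ) (i : I) : derivNorm X (φ lam i) ≠ 0 := by
  obtain ⟨V, ψ, K, h⟩ := (hφ.isNCIFS (T.symm lam)).exists_extension
  have := h.wordNorm_ne_zero hX.hasFatCones.uniqueDiffOn hX.nonempty le_rfl (fun _ : Fin 1 => i)
  rw [← fiberSystem_symm_one T φ lam]
  exact this

/-- Each `φ lam i y` is continuous in `y` and measurable in `lam`, hence jointly measurable, and can
be composed. -/
lemma measurable_wordMap (hφ : IsRandomCIFS X m T φ) {n k : ℕ} (hk : 1 ≤ k) (ω : Fin n → I)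
    {x : EuclideanSpace ℝ (Fin d)} (hx : x ∈ X) :
    Measurable fun lam => wordMap (fiberSystem T φ lam) n k ω x := by
  induction n generalizing k with
  | zero => exact measurable_const
  | succ n ih =>
    have hjoint : Measurable (Function.uncurry fun (y : X) (lam : Λ) => φ lam (ω 0) y) :=
      measurable_uncurry_of_continuous_of_measurable
        (fun lam => (hφ.continuousOn lam (ω 0)).domRestrict)
        (fun y => hφ.measurable (ω 0) y y.2)
    have hmem : ∀ lam, wordMap (fiberSystem T φ lam) n (k + 1) (Fin.tail ω) x ∈ X := fun lam =>
      mapsTo_wordMap (fun j _ i => hφ.mapsTo (T^[j] lam) i) (by omega) _ hx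
    exact hjoint.comp (((ih (k := k + 1) (by omega) (Fin.tail ω)).subtype_mk (h := hmem)).prodMk
      (T.measurable.iterate k))

/-- By conformality the norm of the derivative is its length on one unit vector, which is a limit of
difference quotients inside `X`. -/
lemma measurable_enorm_fderivWithin [Nontrivial (EuclideanSpace ℝ (Fin d))]
    (hφ : IsRandomCIFS X m T φ) {n : ℕ} (ω : Fin n → I)
    {x : EuclideanSpace ℝ (Fin d)} (hx : x ∈ interior X) :
    Measurable fun lam => ‖fderivWithin ℝ (wordMap (fiberSystem T φ lam) n 1 ω) X x‖ₑ := by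
  obtain ⟨e, he⟩ := exists_norm_eq (EuclideanSpace ℝ (Fin d)) zero_le_one
  have hXx : X ∈ 𝓝 x := mem_interior_iff_mem_nhds.1 hx
  have hconf : ∀ lam, ConformalAt (wordMap (fiberSystem T φ lam) n 1 ω) x := by
    intro lam
    obtain ⟨V, ψ, K, h⟩ := (hφ.isNCIFS lam).exists_extension
    refine (h.conformalAt_word le_rfl ω (h.subset (interior_subset hx))).congr hx isOpen_interior ?_
    exact fun y hy => (h.eqOn_word le_rfl ω (interior_subset hy)).symm
  have heq : ∀ lam, ‖fderivWithin ℝ (wordMap (fiberSystem T φ lam) n 1 ω) X x‖ₑ =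
      ‖fderiv ℝ (wordMap (fiberSystem T φ lam) n 1 ω) x e‖ₑ := by
    intro lam
    rw [fderivWithin_of_mem_nhds hXx, ← ofReal_norm, ← ofReal_norm,
      (hconf lam).isConformalMap_fderiv.norm_apply, he, mul_one]
  simp only [heq]
  refine Measurable.enorm ?_
  have hev : ∀ᶠ c : ℝ in atTop, x + c⁻¹ • e ∈ X := by
    have : Tendsto (fun c : ℝ => x + c⁻¹ • e) atTop (𝓝 (x + (0 : ℝ) • e)) :=
      tendsto_const_nhds.add (tendsto_inv_atTop_zero.smul_const e)
    rw [zero_smul, add_zero] at this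
    exact this.eventually hXx
  obtain ⟨N, hN⟩ := eventually_atTop.1 hev
  have hseq : Tendsto (fun k : ℕ => (k : ℝ) + N) atTop atTop :=
    tendsto_atTop_add_const_right _ _ tendsto_natCast_atTop_atTop
  refine measurable_of_tendsto_metrizable (f := fun (k : ℕ) lam => ((k : ℝ) + N) •
    (wordMap (fiberSystem T φ lam) n 1 ω (x + ((k : ℝ) + N)⁻¹ • e) -
      wordMap (fiberSystem T φ lam) n 1 ω x)) (fun k => ?_) (tendsto_pi_nhds.2 fun lam => ?_)
  · have h1 := hφ.measurable_wordMap le_rfl ω (hN ((k : ℝ) + N) (by simp))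
    have h2 := hφ.measurable_wordMap le_rfl ω (interior_subset hx)
    exact (h1.sub h2).const_smul ((k : ℝ) + N)
  · exact ((hconf lam).differentiableAt.hasFDerivAt.lim_real e).comp hseq

/-- The supremum over the uncountable `X` is replaced by the value at one interior point. Distortion
bounds the loss by `K ^ t`; `K` depends on `lam`, but the growth rate does not see it. -/
lemma measurable_lowerPressure [Nontrivial (EuclideanSpace ℝ (Fin d))] [Countable I]
    (hφ : IsRandomCIFS X m T φ) (hX : IsPhaseSpace X) (t : ℝ≥0) :
    Measurable fun lam => lowerPressure X (fiberSystem T φ lam) t := by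
  have hXu := hX.hasFatCones.uniqueDiffOn
  obtain ⟨x, hx⟩ := hX.interior_nonempty
  set W : Λ → ℕ → ℝ≥0∞ := fun lam n => ∑' ω : Fin n → I,
    ‖fderivWithin ℝ (wordMap (fiberSystem T φ lam) n 1 ω) X x‖ₑ ^ (t : ℝ) with hW
  have hWm : ∀ n, Measurable fun lam => W lam n := fun n =>
    Measurable.tsum fun ω => (hφ.measurable_enorm_fderivWithin ω hx).pow_const _
  have heq : ∀ lam, lowerPressure X (fiberSystem T φ lam) t = ExpGrowth.expGrowthInf (W lam) := by
    intro lam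
    obtain ⟨V, ψ, K, h⟩ := (hφ.isNCIFS lam).exists_extension
    have hxX := interior_subset hx
    rw [lowerPressure_eq_expGrowthInf]
    refine le_antisymm ?_ ?_
    · refine ExpGrowth.expGrowthInf_le_of_eventually_le (b := (K : ℝ≥0∞) ^ (t : ℝ))
        (ENNReal.rpow_ne_top_of_nonneg t.coe_nonneg ENNReal.coe_ne_top)
        (Eventually.of_forall fun n => ?_)
      rw [hW, levelSum, ← ENNReal.tsum_mul_left]
      refine ENNReal.tsum_le_tsum fun ω => ?_
      rw [← ENNReal.mul_rpow_of_nonneg _ _ t.coe_nonneg, h.fderivWithin_word hXu le_rfl ω hxX]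
      exact ENNReal.rpow_le_rpow (h.wordNorm_le hXu le_rfl ω (h.subset hxX)) t.coe_nonneg
    · refine ExpGrowth.expGrowthInf_monotone fun n => ENNReal.tsum_le_tsum fun ω => ?_
      rw [h.fderivWithin_word hXu le_rfl ω hxX]
      exact ENNReal.rpow_le_rpow (h.enorm_fderiv_le hXu le_rfl ω hxX) t.coe_nonneg
  simp only [heq]
  refine Measurable.liminf fun n => ?_
  exact (EReal.monotone_div_right_of_nonneg (by positivity)).measurable.comp
    (ENNReal.measurable_log.comp (hWm n))

/-- For infinite alphabets, almost surely the sizes of the letters do not depend on the level, up to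
a bounded factor. -/
lemma exists_ae_comparable [Nontrivial (EuclideanSpace ℝ (Fin d))] [Countable I]
    [IsProbabilityMeasure m] (hφ : IsRandomCIFS X m T φ) (hX : IsPhaseSpace X)
    (hI : (⨆ i, essSup (fun lam => derivNorm X (φ lam i)) m /
        essInf (fun lam => derivNorm X (φ lam i)) m) < ∞) :
    ∃ (a : I → ℝ≥0∞) (D : ℝ≥0∞), D ≠ ∞ ∧ (∀ i, a i ≠ 0) ∧ (∀ i, a i ≠ ∞) ∧
      ∀ᵐ lam ∂m, ∀ j i, a i ≤ derivNorm X (fiberSystem T φ lam j i) ∧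
        derivNorm X (fiberSystem T φ lam j i) ≤ D * a i := by
  set a : I → ℝ≥0∞ := fun i => essInf (fun lam => derivNorm X (φ lam i)) m with ha
  set b : I → ℝ≥0∞ := fun i => essSup (fun lam => derivNorm X (φ lam i)) m with hb
  have hlow : ∀ i, ∀ᵐ lam ∂m, a i ≤ derivNorm X (φ lam i) := fun i => ae_essInf_le
  have hup : ∀ i, ∀ᵐ lam ∂m, derivNorm X (φ lam i) ≤ b i := fun i => ENNReal.ae_le_essSup _
  have hatop : ∀ i, a i ≠ ∞ := by
    intro i
    obtain ⟨lam, hlam⟩ := (hlow i).exists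
    exact (hlam.trans_lt (hφ.derivNorm_ne_top hX lam i).lt_top).ne
  have hb0 : ∀ i, b i ≠ 0 := by
    intro i
    obtain ⟨lam, hlam⟩ := (hup i).exists
    exact ((pos_iff_ne_zero.2 (hφ.derivNorm_ne_zero hX lam i)).trans_le hlam).ne'
  have hratio : ∀ i, b i / a i ≤ ⨆ i, b i / a i := fun i => le_iSup (fun i => b i / a i) i
  -- Division by 0 of the nonzero `b i` would give the ratio `∞`.
  have ha0 : ∀ i, a i ≠ 0 := by
    intro i h0
    have := (hratio i).trans_lt hI
    rw [h0, ENNReal.div_zero (hb0 i)] at this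
    exact lt_irrefl _ this
  refine ⟨a, ⨆ i, b i / a i, hI.ne, ha0, hatop, ?_⟩
  rw [ae_all_iff]
  intro j
  rw [ae_all_iff]
  intro i
  -- Invariance of `m` carries the bounds for `φ lam` to level `j`; countably many pairs `(j, i)`
  -- leave one null set.
  have hj := (hφ.ergodic.toMeasurePreserving.iterate j).quasiMeasurePreserving.ae
    ((hlow i).and (hup i))
  filter_upwards [hj] with lam hlam
  refine ⟨hlam.1, hlam.2.trans ?_⟩
  exact (ENNReal.div_le_iff (ha0 i) (hatop i)).1 (hratio i)

lemma ae_lowerPressure_shift [Nontrivial (EuclideanSpace ℝ (Fin d))] [Countable I]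
    [IsProbabilityMeasure m] (hφ : IsRandomCIFS X m T φ) (hX : IsPhaseSpace X)
    (hI : Infinite I → (⨆ i, essSup (fun lam => derivNorm X (φ lam i)) m /
        essInf (fun lam => derivNorm X (φ lam i)) m) < ∞) (t : ℝ≥0) :
    ∀ᵐ lam ∂m, lowerPressure X (fiberSystem T φ (T lam)) t =
      lowerPressure X (fiberSystem T φ lam) t := by
  have hXu := hX.hasFatCones.uniqueDiffOn
  simp only [fiberSystem_shift]
  rcases isEmpty_or_nonempty I with hemp | hnon
  · refine Eventually.of_forall fun lam => ?_
    rw [lowerPressure_of_isEmpty, lowerPressure_of_isEmpty]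
  rcases finite_or_infinite I with hfin | hinf
  · refine Eventually.of_forall fun lam => ?_
    obtain ⟨V, ψ, K, h⟩ := (hφ.isNCIFS lam).exists_extension
    exact h.lowerPressure_shift hXu (h.levelSum_ne_zero hXu hX.nonempty le_rfl t)
      (h.levelSum_ne_top hXu hX.nonempty le_rfl t)
  · obtain ⟨a, D, hD, -, -, hcomp⟩ := hφ.exists_ae_comparable hX (hI hinf)
    filter_upwards [hcomp] with lam hlam
    obtain ⟨V, ψ, K, h⟩ := (hφ.isNCIFS lam).exists_extension
    -- Comparability makes the one-level sums infinite at all levels or finite at all levels; in the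
    -- first case both pressures are `⊤`.
    by_cases hsum : ∑' i, a i ^ (t : ℝ) = ∞
    · have hlev : ∀ k, levelSum X (fiberSystem T φ lam) 1 k t = ∞ := by
        intro k
        rw [levelSum_one, ← top_le_iff, ← hsum]
        exact ENNReal.tsum_le_tsum fun i => ENNReal.rpow_le_rpow (hlam k i).1 t.coe_nonneg
      rw [h.lowerPressure_eq_top hXu hX.nonempty (hlev 1)]
      obtain ⟨V', ψ', K', h'⟩ := (hφ.isNCIFS (T lam)).exists_extension
      rw [fiberSystem_shift] at h'
      refine h'.lowerPressure_eq_top hXu hX.nonempty ?_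
      rw [levelSum_shift]
      exact hlev 2
    · refine h.lowerPressure_shift hXu (h.levelSum_ne_zero hXu hX.nonempty le_rfl t) ?_
      rw [levelSum_one]
      refine ne_top_of_le_ne_top (ENNReal.mul_ne_top
        (ENNReal.rpow_ne_top_of_nonneg t.coe_nonneg hD) hsum) ?_
      rw [← ENNReal.tsum_mul_left]
      refine ENNReal.tsum_le_tsum fun i => ?_
      rw [← ENNReal.mul_rpow_of_nonneg _ _ t.coe_nonneg]
      exact ENNReal.rpow_le_rpow (hlam 1 i).2 t.coe_nonneg

lemma ae_lowerPressure_eq [Nontrivial (EuclideanSpace ℝ (Fin d))] [Countable I]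
    [IsProbabilityMeasure m] (hφ : IsRandomCIFS X m T φ) (hX : IsPhaseSpace X)
    (hI : Infinite I → (⨆ i, essSup (fun lam => derivNorm X (φ lam i)) m /
        essInf (fun lam => derivNorm X (φ lam i)) m) < ∞) (t : ℝ≥0) :
    ∀ᵐ lam ∂m, lowerPressure X (fiberSystem T φ lam) t = expectedPressure X m T φ t := by
  obtain ⟨c, hc⟩ := hφ.ergodic.ae_eq_const_of_ae_eq_comp₀
    (hφ.measurable_lowerPressure hX t).nullMeasurable (hφ.ae_lowerPressure_shift hX hI t)
  have hexp : expectedPressure X m T φ t = c := erealExpectation_of_ae_eq_const hc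
  rw [hexp]
  exact hc

/-- One null set serves all `t`, because comparability of letter sizes does not involve `t`. -/
lemma ae_le_dimH_limitSet [Nontrivial (EuclideanSpace ℝ (Fin d))] [Countable I]
    [IsProbabilityMeasure m] (hφ : IsRandomCIFS X m T φ) (hX : IsPhaseSpace X)
    (hI : Infinite I → (⨆ i, essSup (fun lam => derivNorm X (φ lam i)) m /
        essInf (fun lam => derivNorm X (φ lam i)) m) < ∞) :
    ∀ᵐ lam ∂m, ∀ t : ℝ≥0, 0 < lowerPressure X (fiberSystem T φ lam) t →
      (t : ℝ≥0∞) ≤ dimH (limitSet X (fiberSystem T φ lam)) := by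
  rcases finite_or_infinite I with hfin | hinf
  · refine Eventually.of_forall fun lam t hP => ?_
    obtain ⟨V, ψ, K, h⟩ := (hφ.isNCIFS lam).exists_extension
    obtain ⟨η, M, hη⟩ := (hφ.isNCIFS lam).exists_isContracting
    exact h.le_dimH_limitSet_of_finite (hφ.isNCIFS lam).disjoint_images hX.isCompact hX.nonempty
      hX.hasFatCones hη hP
  · obtain ⟨a, D, hD, ha0, hatop, hcomp⟩ := hφ.exists_ae_comparable hX (hI hinf)
    filter_upwards [hcomp] with lam hlam t hP
    obtain ⟨V, ψ, K, h⟩ := (hφ.isNCIFS lam).exists_extension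
    obtain ⟨η, M, hη⟩ := (hφ.isNCIFS lam).exists_isContracting
    exact h.le_dimH_limitSet_of_comparable (hφ.isNCIFS lam).disjoint_images hX.isCompact
      hX.nonempty hX.hasFatCones hη hD ha0 hatop (fun j _ i => (hlam j i).1)
      (fun j _ i => (hlam j i).2) hP

end IsRandomCIFS

end Random

/-! ### Assembly -/

theorem mainTheorem10 {d : ℕ} (hd : 1 ≤ d) {Λ I : Type*} [MeasurableSpace Λ] [Countable I]
    (m : Measure Λ) [IsProbabilityMeasure m] (T : Λ ≃ᵐ Λ)
    (X : Set (EuclideanSpace ℝ (Fin d))) (hX : IsPhaseSpace X)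
    (φ : Λ → I → EuclideanSpace ℝ (Fin d) → EuclideanSpace ℝ (Fin d))
    (hφ : IsRandomCIFS X m T φ)
    (hI : Infinite I →
      (⨆ i, essSup (fun lam => derivNorm X (φ lam i)) m /
        essInf (fun lam => derivNorm X (φ lam i)) m) < ∞) :
    (∀ t : ℝ≥0, ∀ᵐ lam ∂m,
      lowerPressure X (fiberSystem T φ lam) t = expectedPressure X m T φ t) ∧
    ∀ᵐ lam ∂m, dimH (limitSet X (fiberSystem T φ lam)) =
      ⨅ (t : ℝ≥0) (_ : expectedPressure X m T φ t ≤ 0), (t : ℝ≥0∞) := by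
  have : Nontrivial (EuclideanSpace ℝ (Fin d)) :=
    Module.nontrivial_of_finrank_pos (R := ℝ) (by simpa using Nat.lt_of_succ_le hd)
  have hae := hφ.ae_lowerPressure_eq hX hI
  refine ⟨hae, ?_⟩
  -- Two given exponents share a fibre where both pressures equal their expectations, so
  -- monotonicity passes from fibres to the expectation.
  have hanti : Antitone (expectedPressure X m T φ) := by
    intro s t hst
    obtain ⟨lam, hs, ht⟩ := ((hae s).and (hae t)).exists
    obtain ⟨η, M, hη⟩ := (hφ.isNCIFS lam).exists_isContracting
    rw [← hs, ← ht]
    exact hη.antitone_lowerPressure hst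
  have hrat : ∀ᵐ lam ∂m, ∀ q : ℚ, lowerPressure X (fiberSystem T φ lam) (Real.toNNReal q) =
      expectedPressure X m T φ (Real.toNNReal q) := ae_all_iff.2 fun q => hae _
  filter_upwards [hrat, hφ.ae_le_dimH_limitSet hX hI] with lam hlam hlower
  refine le_antisymm (le_iInf₂ fun t ht => ?_) ?_
  · obtain ⟨V, ψ, K, h⟩ := (hφ.isNCIFS lam).exists_extension
    obtain ⟨η, M, hη⟩ := (hφ.isNCIFS lam).exists_isContracting
    -- The fibre is known to have the expected pressure only at rational exponents, so `t` is
    -- approached from above by rationals, where the expected pressure is still nonpositive.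
    refine le_of_forall_gt_imp_ge_of_dense fun b hb => ?_
    obtain ⟨q, -, htq, hqb⟩ := ENNReal.lt_iff_exists_rat_btwn.1 hb
    refine le_trans ?_ hqb.le
    refine h.dimH_limitSet_le hX.hasFatCones.uniqueDiffOn hX.isCompact hX.nonempty hη ?_
    rw [hlam q]
    exact (hanti (by exact_mod_cast htq.le)).trans ht
  · refine le_of_forall_lt_imp_le_of_dense fun b hb => ?_
    obtain ⟨q, -, hbq, hq⟩ := ENNReal.lt_iff_exists_rat_btwn.1 hb
    refine hbq.le.trans (hlower _ ?_)
    rw [hlam q]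
    -- A rational below the infimum has positive expected pressure, since otherwise it would belong
    -- to the set.
    by_contra hle
    exact absurd (iInf₂_le (f := fun (t : ℝ≥0) (_ : expectedPressure X m T φ t ≤ 0) =>
      (t : ℝ≥0∞)) _ (not_lt.1 hle)) (not_le.2 hq)
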